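/- Conventions. Vector operations and inequalities are componentwise. A $D$-norm on $\mathbb{R}^d$ is a function of the form $\|x\|_D = E\big(\max_{1\le j\le d} |x_j| Z_j\big)$, where $Z=(Z_1,\dots,Z_d)$ is a random vector with $Z_j\ge 0$ and $E(Z_j)=1$ for all $j$. A copula $C$ is the distribution function of a random vector whose components are all uniform on $[0,1]$; it is a copula of a distribution function $F$ with margins $F_1,\dots,F_d$ if $F(x)=C(F_1(x_1),\dots,F_d(x_d))$ for all $x\in\mathbb{R}^d$. Put $F_j^{-1}(q)=\inf\{t\in\mathbb{R}: F_j(t)\ge q\}$ for $q\in(0,1)$ (values outside $(0,1)$ are irrelevant below; take any fixed convention, e.g. $0$ when the infimum is not a real number). Let $\|\cdot\|_D$ be a $D$-norm which has partial derivatives of order $d$ on $(-\infty,0)^d$, in the sense that for every nonempty block of indices $i_1<\dots<i_k$ in $\{1,\dots,d\}$ the iterated partial derivative $\frac{\partial^k}{\partial x_{i_1}\cdots\partial x_{i_k}}\|x\|_D$ exists at every $x\in(-\infty,0)^d$. Let $\eta=(\eta_1,\dots,\eta_d)$ be a random vector with the standard multivariate max-stable distribution function $G(x)=\exp(-\|x\|_D)$,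 $x\le 0$. Let $X$ be a random vector in $\mathbb{R}^d$ with an arbitrary distribution function $F$, with margins $F_1,\dots,F_d$, and let $C$ be a copula of $F$. Let $X^{(1)},X^{(2)},\dots$ be independent copies of $X$ and let $M^{(n)}=\big(\max_{1\le i\le n}X^{(i)}_1,\dots,\max_{1\le i\le n}X^{(i)}_d\big)$. Suppose that one of the following holds. (a) $C$ is a generalized Pareto copula with $D$-norm $\|\cdot\|_D$: there is $u_0\in(0,1)^d$ such that $C(u)=1-\|1-u\|_D$ for all $u\in[u_0,1]$. (b) $C(u)=1-\|1-u\|_D+o(\|1-u\|)$ as $u\to 1$, uniformly for $u\in[0,1]^d$; and for every $x\in(-\infty,0)^d$ and every nonempty block of indices $i_1<\dots<i_k$ in $\{1,\dots,d\}$, the iterated partial derivative on the left below exists at $x$ for all sufficiently large $n$ (depending on $x$ and the block), and $$\frac{\partial^k}{\partial x_{i_1}\cdots\partial x_{i_k}}\, n\left(C\left(1+\frac{x}{n}\right)-1\right)\longrightarrow_{n\to\infty} -\frac{\partial^k}{\partial x_{i_1}\cdots\partial x_{i_k}}\|x\|_D .$$ Then $$\sup_{A}\left|P\left(M^{(n)}\in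 A\right)-P\left(\left(F_1^{-1}\left(1+\tfrac1n\eta_1\right),\dots,F_d^{-1}\left(1+\tfrac1n\eta_d\right)\right)\in A\right)\right|\longrightarrow_{n\to\infty}0,$$ where the supremum is over all Borel sets $A\subset\mathbb{R}^d$. -/

import Mathlib

open MeasureTheory ProbabilityTheory Filter Asymptotics
open scoped Topology

/-- The distribution function `x ↦ μ((-∞, x])` of a measure on `ℝ^d`. -/
noncomputable def jointCdf {d : ℕ} (μ : Measure (Fin d → ℝ)) (x : Fin d → ℝ) : ℝ :=
  μ.real (Set.Iic x)

/-- The `j`-th marginal distribution function of a measure on `ℝ^d`. -/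
noncomputable def marginCdf {d : ℕ} (μ : Measure (Fin d → ℝ)) (j : Fin d) (t : ℝ) : ℝ :=
  cdf (μ.map (fun x => x j)) t

/-- The generalized inverse `F⁻¹(q) = inf {t : F(t) ≥ q}`; meaningful for `q ∈ (0,1)`. -/
noncomputable def quantile (F : ℝ → ℝ) (q : ℝ) : ℝ := sInf {t : ℝ | q ≤ F t}

/-- A measure on `ℝ^d` follows a copula: it is a probability measure all of whose margins are
uniform on `[0,1]`. The copula itself, as a function, is `jointCdf κ`. -/
structure IsCopula {d : ℕ} (κ : Measure (Fin d → ℝ)) : Prop where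
  isProb : IsProbabilityMeasure κ
  margin : ∀ j, κ.map (fun x => x j) = volume.restrict (Set.Icc (0 : ℝ) 1)

/-- `C` is a copula of the law `μ` (Sklar): `F(x) = C(F_1(x_1), …, F_d(x_d))`, `C = jointCdf κ`. -/
def IsCopulaOf {d : ℕ} (κ μ : Measure (Fin d → ℝ)) : Prop :=
  IsCopula κ ∧ ∀ x, jointCdf μ x = jointCdf κ (fun j => marginCdf μ j (x j))

/-- `N` is a `D`-norm: `N x = E (max_j |x_j| Z_j)` for a random vector `Z` (with law `ρ`) such that
`Z_j ≥ 0` and `E Z_j = 1`. -/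
def IsDNorm {d : ℕ} (N : (Fin d → ℝ) → ℝ) : Prop :=
  ∃ ρ : Measure (Fin d → ℝ), IsProbabilityMeasure ρ ∧
    (∀ᵐ z ∂ρ, ∀ j, 0 ≤ z j) ∧
    (∀ j, Integrable (fun z : Fin d → ℝ => z j) ρ ∧ ∫ z, z j ∂ρ = 1) ∧
    ∀ x, N x = ∫ z, (⨆ j, |x j| * z j) ∂ρ

/-- The iterated partial derivative `∂_{i_1} ⋯ ∂_{i_k} f` for the list `[i_1, …, i_k]`. -/
noncomputable def iterPartial {d : ℕ} (f : (Fin d → ℝ) → ℝ) :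
    List (Fin d) → (Fin d → ℝ) → ℝ
  | [], x => f x
  | i :: l, x => deriv (fun t => iterPartial f l (Function.update x i t)) (x i)

/-- The iterated partial derivative `∂_{i_1} ⋯ ∂_{i_k} f` exists at `x`: the derivative
`∂_{i_2} ⋯ ∂_{i_k} f` exists at all points near `x` on the line through `x` in direction `i_1`, and
is differentiable along this line at `x`. -/
def HasIterPartial {d : ℕ} (f : (Fin d → ℝ) → ℝ) : List (Fin d) → (Fin d → ℝ) → Prop
  | [], _ => True
  | i :: l, x => (∀ᶠ t in 𝓝 (x i), HasIterPartial f l (Function.update x i t)) ∧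
      DifferentiableAt ℝ (fun t => iterPartial f l (Function.update x i t)) (x i)

/-- A nonempty block `B = (i_1, …, i_k)` of indices from `{1, …, d}`, written increasingly. -/
def IsBlock {d : ℕ} (l : List (Fin d)) : Prop := l ≠ [] ∧ l.Pairwise (· < ·)

/-- Existence of the (mixed) partial derivatives up to order `d` of `N` on `(-∞,0)^d`. -/
def HasBlockPartials {d : ℕ} (N : (Fin d → ℝ) → ℝ) : Prop :=
  ∀ x : Fin d → ℝ, (∀ j, x j < 0) → ∀ l, IsBlock l → HasIterPartial N l x

/-- Generalized Pareto copula: `C(u) = 1 - N(1 - u)` on some upper interval `[u₀, 1]`. -/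
def IsGPC {d : ℕ} (C N : (Fin d → ℝ) → ℝ) : Prop :=
  ∃ u₀ : Fin d → ℝ, (∀ j, 0 < u₀ j ∧ u₀ j < 1) ∧ ∀ u ∈ Set.Icc u₀ 1, C u = 1 - N (1 - u)

/-- The expansion `C(u) = 1 - N(1 - u) + o(‖1 - u‖)` as `u → 1`, uniformly for `u ∈ [0,1]^d`. -/
def HasExpansion {d : ℕ} (C N : (Fin d → ℝ) → ℝ) : Prop :=
  (fun u => C u - (1 - N (1 - u))) =o[𝓝[Set.Icc 0 1] 1] (fun u : Fin d → ℝ => 1 - u)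

/-- The function `x ↦ n (C(1 + x/n) - 1)`. -/
noncomputable def scaledTail {d : ℕ} (C : (Fin d → ℝ) → ℝ) (n : ℕ) (x : Fin d → ℝ) : ℝ :=
  n * (C (fun j => 1 + x j / n) - 1)

/-- For every `x < 0` and every nonempty block, the partial derivative of `n (C(1 + x/n) - 1)` over
the block exists for all large `n` and converges to that of `-N` as `n → ∞`. -/
def HasPartialLimits {d : ℕ} (C N : (Fin d → ℝ) → ℝ) : Prop :=
  ∀ x : Fin d → ℝ, (∀ j, x j < 0) → ∀ l, IsBlock l →
    (∀ᶠ n : ℕ in atTop, HasIterPartial (scaledTail C n) l x) ∧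
    Tendsto (fun n : ℕ => iterPartial (scaledTail C n) l x) atTop
      (𝓝 (iterPartial (fun y => -N y) l x))

/-- The componentwise maximum of the first `n` vectors (meaningful for `n ≥ 1`). -/
noncomputable def compMax {Ω : Type*} {d : ℕ} (X : ℕ → Ω → Fin d → ℝ) (n : ℕ) (ω : Ω) :
    Fin d → ℝ :=
  fun j => ⨆ i : Fin n, X i ω j

/-! ### Iterated partial derivatives -/

/-! Both vectors are images of copula-scale vectors under one measurable map, the quantile
transformation of `1 + y / n`: by Sklar's identity the law of the maximum is the image of
`scaledMaxLaw κ n` (`map_compMax_eq_map_scaledMaxLaw`). Preimages of Borel sets are Borel, so it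
suffices to show that `scaledMaxLaw κ n` converges in total variation to the law of `η`. The margins
of `F` then play no further role, and they may be discontinuous.

On the copula scale the argument is Scheffé's. The distribution function there is `(1 + s / n) ^ n`
with `s = scaledTail C n`. Faà di Bruno's formula (`iterPartial_comp`) writes its full mixed
derivative through the block derivatives of `s`, which converge to those of `-N`; every derivative
of the outer power converges to `exp`. Hence the mixed derivatives converge pointwise on the
negative orthant to that of `exp (-N)`.

The difficulty is that mixed derivatives are known only to exist, without continuity, and for a
given `n` perhaps at few points, so they need not be densities. They are replaced by
`fullLowerDensity`, an iterated lower limit of box quotients. It is measurable and defined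
everywhere, agrees with the mixed derivative wherever that exists (`ofReal_iterPartial_jointCdf`),
and by Tonelli and Fatou integrates over any set to at most its measure
(`setLIntegral_fullLowerDensity_le`). For the limit law the mixed derivative exists on the whole
orthant, and an iterated fundamental theorem of calculus gives the reverse bound
(`measure_negOrthant_le`), so there it is a genuine density. For the approximating laws the
one-sided bound is enough in Scheffé's lemma (`exists_tendsto_zero_abs_sub_le`). -/

theorem iterPartial_congr {d : ℕ} {f g : (Fin d → ℝ) → ℝ} {U : Set (Fin d → ℝ)} (hU : IsOpen U)
    (h : ∀ x ∈ U, f x = g x) (l : List (Fin d)) {x : Fin d → ℝ} (hx : x ∈ U) :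
    iterPartial f l x = iterPartial g l x := by
  induction l generalizing x with
  | nil => exact h x hx
  | cons i l ih =>
    refine Filter.EventuallyEq.deriv_eq ?_
    have hc : ContinuousAt (fun t : ℝ => Function.update x i t) (x i) := by fun_prop
    have hm : U ∈ 𝓝 (Function.update x i (x i)) := by
      rw [Function.update_eq_self]; exact hU.mem_nhds hx
    filter_upwards [hc.eventually_mem hm] with t ht using ih ht

theorem HasIterPartial.congr {d : ℕ} {f g : (Fin d → ℝ) → ℝ} {U : Set (Fin d → ℝ)}
    (hU : IsOpen U) (h : ∀ x ∈ U, f x = g x) (l : List (Fin d)) {x : Fin d → ℝ} (hx : x ∈ U)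
    (hf : HasIterPartial f l x) : HasIterPartial g l x := by
  induction l generalizing x with
  | nil => trivial
  | cons i l ih =>
    have hc : ContinuousAt (fun t : ℝ => Function.update x i t) (x i) := by fun_prop
    have hm : U ∈ 𝓝 (Function.update x i (x i)) := by
      rw [Function.update_eq_self]; exact hU.mem_nhds hx
    have he := hc.eventually_mem hm
    refine ⟨?_, ?_⟩
    · filter_upwards [he, hf.1] with t ht hft using ih ht hft
    · refine hf.2.congr_of_eventuallyEq ?_
      filter_upwards [he] with t ht using (iterPartial_congr hU h l ht).symm

theorem iterPartial_neg {d : ℕ} (f : (Fin d → ℝ) → ℝ) (l : List (Fin d)) (x : Fin d → ℝ) :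
    iterPartial (fun y => -f y) l x = -iterPartial f l x := by
  induction l generalizing x with
  | nil => rfl
  | cons i l ih => simp only [iterPartial, ih, deriv.fun_neg]

theorem HasIterPartial.neg {d : ℕ} {f : (Fin d → ℝ) → ℝ} {l : List (Fin d)} {x : Fin d → ℝ}
    (h : HasIterPartial f l x) : HasIterPartial (fun y => -f y) l x := by
  induction l generalizing x with
  | nil => trivial
  | cons i l ih =>
    refine ⟨h.1.mono fun t ht => ih ht, ?_⟩
    simp only [iterPartial_neg]
    exact h.2.fun_neg

theorem HasIterPartial.hasDerivAt {d : ℕ} {f : (Fin d → ℝ) → ℝ} {i : Fin d} {l : List (Fin d)}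
    {x : Fin d → ℝ} (h : HasIterPartial f (i :: l) x) :
    HasDerivAt (fun t => iterPartial f l (Function.update x i t)) (iterPartial f (i :: l) x)
      (x i) :=
  h.2.hasDerivAt

/-- All ways to put `i` in front of one block of `π`. -/
def extendBlocks {ι : Type*} (i : ι) : List (List ι) → List (List (List ι))
  | [] => []
  | b :: π => ((i :: b) :: π) :: (extendBlocks i π).map (b :: ·)

/-- All partitions of a list into blocks, each a sublist. -/
def listPartitions {ι : Type*} : List ι → List (List (List ι))
  | [] => [[]]
  | i :: l => (listPartitions l).flatMap fun π => ([i] :: π) :: extendBlocks i π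

theorem sublist_of_mem_extendBlocks {ι : Type*} {i : ι} {l : List ι} {π π' : List (List ι)}
    (h : ∀ b ∈ π, b.Sublist l) (hπ : π' ∈ extendBlocks i π) :
    ∀ b ∈ π', b.Sublist (i :: l) := by
  induction π generalizing π' with
  | nil => simp [extendBlocks] at hπ
  | cons c π ih =>
    simp only [extendBlocks, List.mem_cons, List.mem_map] at hπ
    simp only [List.mem_cons, forall_eq_or_imp] at h
    rcases hπ with rfl | ⟨τ, hτ, rfl⟩
    · intro b hb
      rcases List.mem_cons.1 hb with rfl | hb
      · exact h.1.cons_cons i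
      · exact (h.2 b hb).cons i
    · intro b hb
      rcases List.mem_cons.1 hb with rfl | hb
      · exact h.1.cons i
      · exact ih h.2 hτ b hb

/-- Sublists inherit the increasing order, so every block met in Faà di Bruno's formula for
`List.finRange d` is one to which the hypotheses on increasing blocks apply. -/
theorem sublist_of_mem_listPartitions {ι : Type*} {l : List ι} {π : List (List ι)}
    (hπ : π ∈ listPartitions l) : ∀ b ∈ π, b.Sublist l := by
  induction l generalizing π with
  | nil => simp [listPartitions] at hπ; simp [hπ]
  | cons i l ih =>
    simp only [listPartitions, List.mem_flatMap, List.mem_cons] at hπ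
    obtain ⟨τ, hτ, rfl | h⟩ := hπ
    · intro b hb
      rcases List.mem_cons.1 hb with rfl | hb
      · simp
      · exact (ih hτ b hb).cons i
    · exact sublist_of_mem_extendBlocks (ih hτ) h

theorem length_of_mem_extendBlocks {ι : Type*} {i : ι} {π π' : List (List ι)}
    (hπ : π' ∈ extendBlocks i π) : π'.length = π.length := by
  induction π generalizing π' with
  | nil => simp [extendBlocks] at hπ
  | cons c π ih =>
    simp only [extendBlocks, List.mem_cons, List.mem_map] at hπ
    rcases hπ with rfl | ⟨τ, hτ, rfl⟩
    · rfl
    · simp [ih hτ]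

/-- The contribution of the partition `π` to an iterated partial derivative of `ψ ∘ f`, where
`ψ k` is the `k`-th derivative of `ψ`. -/
noncomputable def partitionTerm {d : ℕ} (ψ : ℕ → ℝ → ℝ) (f : (Fin d → ℝ) → ℝ)
    (π : List (List (Fin d))) (x : Fin d → ℝ) : ℝ :=
  ψ π.length (f x) * (π.map fun b => iterPartial f b x).prod

theorem hasDerivAt_blockProd {d : ℕ} {f : (Fin d → ℝ) → ℝ} {i : Fin d} {x : Fin d → ℝ}
    {π : List (List (Fin d))} (h : ∀ b ∈ π, HasIterPartial f (i :: b) x) :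
    HasDerivAt (fun t => (π.map fun b => iterPartial f b (Function.update x i t)).prod)
      ((extendBlocks i π).map fun π' => (π'.map fun b => iterPartial f b x).prod).sum (x i) := by
  induction π with
  | nil => simpa [extendBlocks] using hasDerivAt_const (x i) (1 : ℝ)
  | cons b π ih =>
    simp only [List.mem_cons, forall_eq_or_imp] at h
    have := h.1.hasDerivAt.fun_mul (ih h.2)
    refine this.congr_deriv ?_
    simp [extendBlocks, Function.comp_def, List.sum_map_mul_left, iterPartial]

/-- Differentiating the outer factor creates the new singleton block `[i]` and raises the order of
`ψ`; differentiating the product adds `i` to one existing block and leaves the order unchanged. -/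
theorem hasDerivAt_partitionTerm {d : ℕ} {ψ : ℕ → ℝ → ℝ}
    (hψ : ∀ k y, HasDerivAt (ψ k) (ψ (k + 1) y) y) {f : (Fin d → ℝ) → ℝ} {i : Fin d}
    {x : Fin d → ℝ} {π : List (List (Fin d))} (hf : HasIterPartial f [i] x)
    (h : ∀ b ∈ π, HasIterPartial f (i :: b) x) :
    HasDerivAt (fun t => partitionTerm ψ f π (Function.update x i t))
      ((([i] :: π) :: extendBlocks i π).map fun π' => partitionTerm ψ f π' x).sum (x i) := by
  have h1 : HasDerivAt (fun t => ψ π.length (f (Function.update x i t)))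
      (ψ (π.length + 1) (f x) * iterPartial f [i] x) (x i) := by
    have hf' : HasDerivAt (fun t => f (Function.update x i t)) (iterPartial f [i] x) (x i) :=
      hf.hasDerivAt
    have := (hψ π.length (f (Function.update x i (x i)))).comp (x i) hf'
    simpa [Function.comp_def, Function.update_eq_self] using this
  have := h1.fun_mul (hasDerivAt_blockProd h)
  refine this.congr_deriv ?_
  simp only [List.map_cons, List.sum_cons, partitionTerm, List.length_cons, List.prod_cons,
    Function.update_eq_self]
  rw [mul_assoc, ← List.sum_map_mul_left]
  congr 2
  exact List.map_congr_left fun π' hπ' => by rw [length_of_mem_extendBlocks hπ']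

theorem hasDerivAt_list_sum {α : Type*} {s : List α} {g : α → ℝ → ℝ} {g' : α → ℝ} {y : ℝ}
    (h : ∀ a ∈ s, HasDerivAt (g a) (g' a) y) :
    HasDerivAt (fun t => (s.map fun a => g a t).sum) (s.map g').sum y := by
  induction s with
  | nil => simpa using hasDerivAt_const y (0 : ℝ)
  | cons a s ih =>
    simp only [List.mem_cons, forall_eq_or_imp] at h
    simpa using h.1.fun_add (ih h.2)

/-- Faà di Bruno's formula for iterated partial derivatives. -/
theorem iterPartial_comp {d : ℕ} {ψ : ℕ → ℝ → ℝ}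
    (hψ : ∀ k y, HasDerivAt (ψ k) (ψ (k + 1) y) y) {f : (Fin d → ℝ) → ℝ} (l : List (Fin d))
    {x : Fin d → ℝ} (h : ∀ l', l'.Sublist l → HasIterPartial f l' x) :
    HasIterPartial (fun y => ψ 0 (f y)) l x ∧ iterPartial (fun y => ψ 0 (f y)) l x =
      ((listPartitions l).map fun π => partitionTerm ψ f π x).sum := by
  induction l generalizing x with
  | nil => exact ⟨trivial, by simp [listPartitions, partitionTerm, iterPartial]⟩
  | cons i l ih =>
    -- The formula for `l` is needed along a whole neighbourhood on the line in direction `i`; there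
    -- are finitely many sublists, so one neighbourhood serves them all.
    have hev : ∀ᶠ t in 𝓝 (x i), ∀ l' ∈ l.sublists, HasIterPartial f l' (Function.update x i t) := by
      have hfin : {l' | l' ∈ l.sublists}.Finite := List.finite_toSet _
      exact (eventually_all_finite hfin).2 fun l' hl' =>
        (h (i :: l') ((List.mem_sublists.1 hl').cons_cons i)).1
    have hih : ∀ᶠ t in 𝓝 (x i), HasIterPartial (fun y => ψ 0 (f y)) l (Function.update x i t) ∧
        iterPartial (fun y => ψ 0 (f y)) l (Function.update x i t) =
        ((listPartitions l).map fun π => partitionTerm ψ f π (Function.update x i t)).sum :=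
      hev.mono fun t ht => ih fun l' hl' => ht l' (List.mem_sublists.2 hl')
    have hd : HasDerivAt (fun t => iterPartial (fun y => ψ 0 (f y)) l (Function.update x i t))
        ((listPartitions (i :: l)).map fun π => partitionTerm ψ f π x).sum (x i) := by
      have h1 : HasDerivAt (fun t => ((listPartitions l).map fun π =>
          partitionTerm ψ f π (Function.update x i t)).sum) _ (x i) :=
        hasDerivAt_list_sum fun π hπ => hasDerivAt_partitionTerm hψ (h [i] (by simp))
          fun b hb => h (i :: b) ((sublist_of_mem_listPartitions hπ b hb).cons_cons i)
      refine (h1.congr_of_eventuallyEq (hih.mono fun t ht => ht.2)).congr_deriv ?_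
      rw [listPartitions, List.map_flatMap, List.flatMap, List.sum_flatten, List.map_map]
      rfl
    exact ⟨⟨hih.mono fun t ht => ht.1, hd.differentiableAt⟩, hd.deriv⟩

theorem tendsto_partitionTerm_sum {d : ℕ} {ψ : ℕ → ℕ → ℝ → ℝ} {f : ℕ → (Fin d → ℝ) → ℝ}
    {φ : ℕ → ℝ → ℝ} {f₀ : (Fin d → ℝ) → ℝ} {l : List (Fin d)} {x : Fin d → ℝ}
    (hψ : ∀ k, Tendsto (fun n => ψ n k (f n x)) atTop (𝓝 (φ k (f₀ x))))
    (hf : ∀ l', l'.Sublist l → Tendsto (fun n => iterPartial (f n) l' x) atTop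
      (𝓝 (iterPartial f₀ l' x))) :
    Tendsto (fun n => ((listPartitions l).map fun π => partitionTerm (ψ n) (f n) π x).sum) atTop
      (𝓝 ((listPartitions l).map fun π => partitionTerm φ f₀ π x).sum) :=
  tendsto_list_sum _ fun π hπ => (hψ π.length).mul <|
    tendsto_list_prod _ fun b hb => hf b (sublist_of_mem_listPartitions hπ b hb)

/-! ### The powers `(1 + y / n) ^ n` -/

/-- The `k`-th derivative of `y ↦ (1 + y / n) ^ n`. -/
noncomputable def powDeriv (n k : ℕ) (y : ℝ) : ℝ :=
  (n.descFactorial k : ℝ) / n ^ k * (1 + y / n) ^ (n - k)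

theorem hasDerivAt_powDeriv (n k : ℕ) (y : ℝ) :
    HasDerivAt (powDeriv n k) (powDeriv n (k + 1) y) y := by
  have h1 : HasDerivAt (fun y : ℝ => 1 + y / n) (1 / n) y :=
    ((hasDerivAt_id y).div_const (n : ℝ)).const_add 1
  have := (h1.fun_pow (n - k)).const_mul ((n.descFactorial k : ℝ) / n ^ k)
  refine this.congr_deriv ?_
  -- No case split is needed: for `k ≥ n` the truncated factor `n - k` makes both sides zero.
  rw [powDeriv, Nat.descFactorial_succ, ← Nat.sub_sub, pow_succ]
  push_cast
  rw [mul_comm ((n - k : ℕ) : ℝ) (n.descFactorial k : ℝ), mul_div_mul_comm]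
  ring

theorem tendsto_descFactorial_div_pow (k : ℕ) :
    Tendsto (fun n : ℕ => (n.descFactorial k : ℝ) / n ^ k) atTop (𝓝 1) := by
  induction k with
  | zero => simp
  | succ k ih =>
    have h1 : Tendsto (fun n : ℕ => 1 - (k : ℝ) / n) atTop (𝓝 1) := by
      simpa using (tendsto_const_div_atTop_nhds_zero_nat (k : ℝ)).const_sub 1
    have := h1.mul ih
    rw [mul_one] at this
    refine this.congr' ?_
    filter_upwards [eventually_ge_atTop (k + 1)] with n hn
    have : (n : ℝ) ≠ 0 := by
      have : n ≠ 0 := by omega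
      exact_mod_cast this
    rw [Nat.descFactorial_succ, pow_succ, Nat.cast_mul, Nat.cast_sub (by omega)]
    field_simp

/-- The limit is independent of `k`: the coefficient tends to `1`, and dropping `k` of the `n`
factors divides by a quantity tending to `1`. -/
theorem tendsto_powDeriv {y : ℕ → ℝ} {y₀ : ℝ} (hy : Tendsto y atTop (𝓝 y₀)) (k : ℕ) :
    Tendsto (fun n => powDeriv n k (y n)) atTop (𝓝 (Real.exp y₀)) := by
  have h0 : Tendsto (fun n : ℕ => 1 + y n / n) atTop (𝓝 1) := by
    simpa using (hy.div_atTop tendsto_natCast_atTop_atTop).const_add 1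
  have h1 : Tendsto (fun n : ℕ => (1 + y n / n) ^ n) atTop (𝓝 (Real.exp y₀)) := by
    refine Real.tendsto_one_add_pow_exp_of_tendsto (hy.congr' ?_)
    filter_upwards [eventually_ne_atTop 0] with n hn
    have : (n : ℝ) ≠ 0 := by exact_mod_cast hn
    field_simp
  have h2 := (tendsto_descFactorial_div_pow k).mul (h1.div (h0.pow k) (by simp))
  simp only [one_pow, div_one, one_mul] at h2
  refine h2.congr' ?_
  filter_upwards [eventually_ge_atTop k, h0.eventually_ne one_ne_zero] with n hn hne
  rw [powDeriv, pow_sub₀ _ hne hn]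
  rfl

/-! ### Iterated increments -/

/-- The iterated increment of `f` over the intervals `(a, b]` in direction `i`, for the members
`(i, a, b)` of a list. -/
def incr {d : ℕ} (f : (Fin d → ℝ) → ℝ) : List (Fin d × ℝ × ℝ) → (Fin d → ℝ) → ℝ
  | [], x => f x
  | c :: p, x => incr f p (Function.update x c.1 c.2.2) - incr f p (Function.update x c.1 c.2.1)

/-- `P` holds at all points at which `incr f p x` evaluates `f`. -/
def AtCorners {d : ℕ} (P : (Fin d → ℝ) → Prop) : List (Fin d × ℝ × ℝ) → (Fin d → ℝ) → Prop
  | [], x => P x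
  | c :: p, x => AtCorners P p (Function.update x c.1 c.2.2) ∧
      AtCorners P p (Function.update x c.1 c.2.1)

/-- The points between the corners: those whose jointCdf increment is `incr`. -/
def incrSet {d : ℕ} (p : List (Fin d × ℝ × ℝ)) (x : Fin d → ℝ) : Set (Fin d → ℝ) :=
  {y | (∀ c ∈ p, c.2.1 < y c.1 ∧ y c.1 ≤ c.2.2) ∧ ∀ j, j ∉ p.map Prod.fst → y j ≤ x j}

theorem AtCorners.mono {d : ℕ} {P P' : (Fin d → ℝ) → Prop} (h : ∀ x, P x → P' x)
    {p : List (Fin d × ℝ × ℝ)} {x : Fin d → ℝ} (hp : AtCorners P p x) : AtCorners P' p x := by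
  induction p generalizing x with
  | nil => exact h x hp
  | cons c p ih => exact ⟨ih hp.1, ih hp.2⟩

theorem AtCorners.of_forall_lt {d : ℕ} {P : (Fin d → ℝ) → Prop} (h : ∀ x, (∀ j, x j < 0) → P x)
    {p : List (Fin d × ℝ × ℝ)} (hp : ∀ c ∈ p, c.2.1 < 0 ∧ c.2.2 < 0) {x : Fin d → ℝ}
    (hx : ∀ j, x j < 0) : AtCorners P p x := by
  induction p generalizing x with
  | nil => exact h x hx
  | cons c p ih =>
    simp only [List.mem_cons, forall_eq_or_imp] at hp
    have key : ∀ t < 0, ∀ j, Function.update x c.1 t j < 0 := fun t ht j => by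
      rcases eq_or_ne j c.1 with rfl | hj
      · simpa using ht
      · simpa [hj] using hx j
    exact ⟨ih hp.2 (key _ hp.1.2), ih hp.2 (key _ hp.1.1)⟩

theorem AtCorners.eventually_update {d : ℕ} {P : (Fin d → ℝ) → Prop} {i : Fin d}
    {p : List (Fin d × ℝ × ℝ)} (hi : i ∉ p.map Prod.fst) {x : Fin d → ℝ}
    (hp : AtCorners (fun y => ∀ᶠ t in 𝓝 (y i), P (Function.update y i t)) p x) :
    ∀ᶠ t in 𝓝 (x i), AtCorners P p (Function.update x i t) := by
  induction p generalizing x with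
  | nil => exact hp
  | cons c p ih =>
    simp only [List.map_cons, List.mem_cons, not_or] at hi
    have h1 := ih hi.2 hp.1
    have h2 := ih hi.2 hp.2
    rw [Function.update_of_ne hi.1] at h1 h2
    filter_upwards [h1, h2] with t ht1 ht2
    rw [Function.update_comm (Ne.symm hi.1)] at ht1 ht2
    exact ⟨ht1, ht2⟩

/-- Differences in the other directions commute with differentiation in direction `i`. -/
theorem hasDerivAt_incr {d : ℕ} {f f' : (Fin d → ℝ) → ℝ} {i : Fin d}
    {p : List (Fin d × ℝ × ℝ)} (hi : i ∉ p.map Prod.fst) {x : Fin d → ℝ}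
    (hp : AtCorners (fun y => HasDerivAt (fun t => f (Function.update y i t)) (f' y) (y i)) p x) :
    HasDerivAt (fun t => incr f p (Function.update x i t)) (incr f' p x) (x i) := by
  induction p generalizing x with
  | nil => exact hp
  | cons c p ih =>
    simp only [List.map_cons, List.mem_cons, not_or] at hi
    have h1 := ih hi.2 hp.1
    have h2 := ih hi.2 hp.2
    rw [Function.update_of_ne hi.1] at h1 h2
    simp only [incr, Function.update_comm hi.1]
    exact h1.fun_sub h2

theorem incrSet_cons {d : ℕ} {c : Fin d × ℝ × ℝ} {p : List (Fin d × ℝ × ℝ)}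
    (hc : c.1 ∉ p.map Prod.fst) (x : Fin d → ℝ) :
    incrSet (c :: p) x =
      incrSet p (Function.update x c.1 c.2.2) \ incrSet p (Function.update x c.1 c.2.1) := by
  ext y
  have key : ∀ t, y ∈ incrSet p (Function.update x c.1 t) ↔
      (∀ c ∈ p, c.2.1 < y c.1 ∧ y c.1 ≤ c.2.2) ∧ y c.1 ≤ t ∧
        ∀ j, j ∉ (c :: p).map Prod.fst → y j ≤ x j := by
    intro t
    refine and_congr_right fun _ => ⟨fun h => ⟨by simpa using h c.1 hc, fun j hj => ?_⟩,
      fun h j hj => ?_⟩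
    · simp only [List.map_cons, List.mem_cons, not_or] at hj
      simpa [hj.1] using h j hj.2
    · rcases eq_or_ne j c.1 with rfl | hne
      · simpa using h.1
      · simpa [hne] using h.2 j (by simp only [List.map_cons, List.mem_cons, not_or]; exact ⟨hne, hj⟩)
  rw [Set.mem_sdiff, key, key]
  simp only [incrSet, Set.mem_ofPred_eq, List.forall_mem_cons]
  grind

theorem incrSet_subset_of_le {d : ℕ} {p : List (Fin d × ℝ × ℝ)} {x x' : Fin d → ℝ} (h : x ≤ x') :
    incrSet p x ⊆ incrSet p x' :=
  fun _ hy => ⟨hy.1, fun j hj => (hy.2 j hj).trans (h j)⟩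

theorem measurableSet_incrSet {d : ℕ} {p : List (Fin d × ℝ × ℝ)} (hp : (p.map Prod.fst).Nodup)
    (x : Fin d → ℝ) : MeasurableSet (incrSet p x) := by
  induction p generalizing x with
  | nil =>
    have : incrSet [] x = Set.Iic x := by ext y; simp [incrSet, Pi.le_def]
    exact this ▸ measurableSet_Iic
  | cons c p ih =>
    rw [List.map_cons, List.nodup_cons] at hp
    rw [incrSet_cons hp.1]
    exact (ih hp.2 _).diff (ih hp.2 _)

/-- Inclusion–exclusion, one direction at a time: each difference is the measure of a difference of
nested sets. -/
theorem incr_jointCdf {d : ℕ} (ν : Measure (Fin d → ℝ)) [IsFiniteMeasure ν]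
    {p : List (Fin d × ℝ × ℝ)} (hp : (p.map Prod.fst).Nodup) (hle : ∀ c ∈ p, c.2.1 ≤ c.2.2)
    (x : Fin d → ℝ) : incr (jointCdf ν) p x = ν.real (incrSet p x) := by
  induction p generalizing x with
  | nil =>
    have : incrSet [] x = Set.Iic x := by ext y; simp [incrSet, Pi.le_def]
    rw [this]; rfl
  | cons c p ih =>
    rw [List.map_cons, List.nodup_cons] at hp
    rw [List.forall_mem_cons] at hle
    rw [incrSet_cons hp.1, measureReal_sdiff
      (incrSet_subset_of_le (update_le_update_iff.2 ⟨hle.1, fun _ _ => le_rfl⟩))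
      (measurableSet_incrSet hp.2 _), incr, ih hp.2 hle.2, ih hp.2 hle.2]

/-! ### A lower bound for the density of a measure -/

/-- The intervals `(x i, x i + h i]`, for `i` in a list. -/
def cells {d : ℕ} (q : List (Fin d)) (h x : Fin d → ℝ) : List (Fin d × ℝ × ℝ) :=
  q.map fun i => (i, x i, x i + h i)

theorem map_fst_cells {d : ℕ} (q : List (Fin d)) (h x : Fin d → ℝ) :
    (cells q h x).map Prod.fst = q := by
  simp [cells, Function.comp_def]

theorem cells_cons_update {d : ℕ} {q : List (Fin d)} {i : Fin d} (hi : i ∉ q) (h x : Fin d → ℝ)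
    (v : ℝ) : cells (i :: q) (Function.update h i v) x = (i, x i, x i + v) :: cells q h x := by
  simp only [cells, List.map_cons, Function.update_self, List.cons.injEq, true_and]
  refine List.map_congr_left fun j hj => ?_
  rw [Function.update_of_ne (by rintro rfl; exact hi hj)]

theorem prod_map_cons_update {d : ℕ} {q : List (Fin d)} {i : Fin d} (hi : i ∉ q) (h : Fin d → ℝ)
    (v : ℝ) : ((i :: q).map (Function.update h i v)).prod = v * (q.map h).prod := by
  rw [List.map_cons, List.prod_cons, Function.update_self]
  congr 2
  exact List.map_congr_left fun j hj =>
    Function.update_of_ne (by rintro rfl; exact hi hj) _ _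

/-- The iterated lower limit of the quotients `ν (x, x + h] / ∏ h`, as the sides `h i = 1 / (m + 1)`
tend to `0` one after the other; the directions in the second list have been treated. -/
noncomputable def lowerDensity {d : ℕ} (ν : Measure (Fin d → ℝ)) :
    List (Fin d) → List (Fin d) → (Fin d → ℝ) → (Fin d → ℝ) → ENNReal
  | [], q, h, x => ν (incrSet (cells q h x) x) / ENNReal.ofReal (q.map h).prod
  | i :: l, q, h, x => liminf (fun m : ℕ =>
      lowerDensity ν l (i :: q) (Function.update h i (1 / ((m : ℝ) + 1))) x) atTop

theorem mem_incrSet_cells {d : ℕ} {q : List (Fin d)} {h x y : Fin d → ℝ} :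
    y ∈ incrSet (cells q h x) x ↔
      (∀ i ∈ q, x i < y i ∧ y i ≤ x i + h i) ∧ ∀ j, j ∉ q → y j ≤ x j := by
  rw [incrSet, Set.mem_ofPred_eq, map_fst_cells]
  simp [cells]

theorem measurableSet_incrSet_cells {d : ℕ} (q : List (Fin d)) (h : Fin d → ℝ) :
    MeasurableSet {z : (Fin d → ℝ) × (Fin d → ℝ) | z.2 ∈ incrSet (cells q h z.1) z.1} := by
  simp only [mem_incrSet_cells, Set.ofPred_and, Set.ofPred_forall]
  refine MeasurableSet.inter (MeasurableSet.iInter fun i => MeasurableSet.iInter fun _ => ?_)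
    (MeasurableSet.iInter fun i => MeasurableSet.iInter fun _ => ?_)
  · exact (measurableSet_lt (by fun_prop) (by fun_prop)).inter
      (measurableSet_le (by fun_prop) (by fun_prop))
  · exact measurableSet_le (by fun_prop) (by fun_prop)

theorem measurable_lowerDensity {d : ℕ} (ν : Measure (Fin d → ℝ)) [SFinite ν]
    (l q : List (Fin d)) (h : Fin d → ℝ) : Measurable (lowerDensity ν l q h) := by
  induction l generalizing q h with
  | nil => exact (measurable_measure_prodMk_left (measurableSet_incrSet_cells q h)).div_const _
  | cons i l ih => exact Measurable.liminf fun m => ih _ _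

theorem tendsto_one_div_add_one_punctured :
    Tendsto (fun m : ℕ => 1 / ((m : ℝ) + 1)) atTop (𝓝[≠] 0) :=
  tendsto_nhdsWithin_iff.2 ⟨tendsto_one_div_add_atTop_nhds_zero_nat,
    Eventually.of_forall fun m => by
      have : (0 : ℝ) < 1 / ((m : ℝ) + 1) := by positivity
      exact this.ne'⟩

/-- Where the iterated partial derivative of the distribution function exists, it is the lower
density. -/
theorem ofReal_incr_iterPartial {d : ℕ} (ν : Measure (Fin d → ℝ)) [IsFiniteMeasure ν]
    {l q : List (Fin d)} (hlq : (l ++ q).Nodup) {h : Fin d → ℝ} (hh : ∀ i ∈ q, 0 < h i)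
    {x : Fin d → ℝ} (hx : AtCorners (HasIterPartial (jointCdf ν) l) (cells q h x) x) :
    ENNReal.ofReal (incr (iterPartial (jointCdf ν) l) (cells q h x) x / (q.map h).prod) =
      lowerDensity ν l q h x := by
  induction l generalizing q h with
  | nil =>
    have hpos : 0 < (q.map h).prod := List.prod_pos (by simpa using hh)
    have : iterPartial (jointCdf ν) [] = jointCdf ν := rfl
    rw [this, incr_jointCdf ν (by rw [map_fst_cells]; simpa using hlq)
      (by simpa [cells] using fun i hi => (hh i hi).le), ENNReal.ofReal_div_of_pos hpos,
      ofReal_measureReal]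
    rfl
  | cons i l ih =>
    have hi : i ∉ q := by
      simp only [List.cons_append, List.nodup_cons, List.mem_append, not_or] at hlq
      exact hlq.1.2
    have hnd : (l ++ i :: q).Nodup := (List.perm_middle.nodup_iff).2 hlq
    have hi' : i ∉ (cells q h x).map Prod.fst := by rwa [map_fst_cells]
    -- A difference quotient in direction `i` with step `1 / (m + 1)` is the increment with one more
    -- cell divided by its side. The induction hypothesis thus identifies the quotients for large
    -- `m`, and their lower limit is the derivative.
    have hd := hasDerivAt_incr hi' (hx.mono fun y hy => hy.hasDerivAt)
    have hev := AtCorners.eventually_update hi' (hx.mono fun y hy => hy.1)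
    have hself := hev.self_of_nhds
    have hev' : ∀ᶠ m : ℕ in atTop, AtCorners (HasIterPartial (jointCdf ν) l) (cells q h x)
        (Function.update x i (x i + 1 / ((m : ℝ) + 1))) := by
      have : Tendsto (fun m : ℕ => x i + 1 / ((m : ℝ) + 1)) atTop (𝓝 (x i)) := by
        simpa using tendsto_one_div_add_atTop_nhds_zero_nat.const_add (x i)
      exact this.eventually hev
    have hlim := (ENNReal.continuous_ofReal.tendsto _).comp
      (((hasDerivAt_iff_tendsto_slope_zero.1 hd).comp
        tendsto_one_div_add_one_punctured).div_const (q.map h).prod)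
    refine (Tendsto.liminf_eq (hlim.congr' ?_)).symm
    filter_upwards [hev'] with m hm
    have hv : (0 : ℝ) < 1 / ((m : ℝ) + 1) := by positivity
    rw [← ih hnd (h := Function.update h i (1 / ((m : ℝ) + 1))) ?_ ?_,
      cells_cons_update hi, prod_map_cons_update hi]
    · simp only [Function.comp_apply, incr, smul_eq_mul]
      rw [div_mul_eq_div_div_swap, div_eq_inv_mul _ (1 / ((m : ℝ) + 1)), mul_div_assoc]
    · intro j hj
      rcases eq_or_ne j i with rfl | hne
      · simpa using hv
      · simpa [hne] using hh j ((List.mem_cons.1 hj).resolve_left hne)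
    · rw [cells_cons_update hi]
      exact ⟨hm, hself⟩

/-- Tonelli: `y` lies in the box `(x, x + h]` exactly when `x` lies in `[y - h, y)`, whose volume is
`∏ h`, and for `x ∈ K` only points `y ∈ O` contribute. -/
theorem lintegral_measure_incrSet_le {d : ℕ} (ν : Measure (Fin d → ℝ)) [IsFiniteMeasure ν]
    {q : List (Fin d)} (hq : q.Nodup) (hall : ∀ j, j ∈ q) {h : Fin d → ℝ} {ε : ℝ}
    (hh : ∀ i, 0 < h i ∧ h i < ε) {K O : Set (Fin d → ℝ)} (hO : MeasurableSet O)
    (hKO : ∀ x ∈ K, ∀ y, (∀ j, x j < y j ∧ y j < x j + ε) → y ∈ O) :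
    ∫⁻ x in K, ν (incrSet (cells q h x) x) ≤ ENNReal.ofReal (q.map h).prod * ν O := by
  have hS := measurableSet_incrSet_cells q h
  have h1 : ∫⁻ x in K, ν (incrSet (cells q h x) x) =
      ∫⁻ y, (volume.restrict K) {x | y ∈ incrSet (cells q h x) x} ∂ν :=
    (Measure.prod_apply hS).symm.trans (Measure.prod_apply_symm hS)
  have hvol : ∀ y : Fin d → ℝ, volume {x : Fin d → ℝ | y ∈ incrSet (cells q h x) x} =
      ENNReal.ofReal (q.map h).prod := by
    intro y
    have : {x : Fin d → ℝ | y ∈ incrSet (cells q h x) x} =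
        Set.univ.pi fun j => Set.Ico (y j - h j) (y j) := by
      ext x
      simp only [Set.mem_ofPred_eq, mem_incrSet_cells, Set.mem_univ_pi, Set.mem_Ico]
      refine ⟨fun hy j => ?_, fun hy => ⟨fun j _ => ?_, fun j hj => absurd (hall j) hj⟩⟩
      · have := hy.1 j (hall j); exact ⟨by linarith, this.1⟩
      · have := hy j; exact ⟨this.2, by linarith⟩
    rw [this, Real.volume_pi_Ico]
    simp only [sub_sub_cancel]
    rw [← ENNReal.ofReal_prod_of_nonneg fun j _ => (hh j).1.le, ← List.prod_toFinset h hq]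
    congr 2
    ext j; simp [hall j]
  rw [h1, ← lintegral_indicator_const hO]
  refine lintegral_mono fun y => ?_
  by_cases hy : y ∈ O
  · rw [Set.indicator_of_mem hy, ← hvol y]
    exact Measure.restrict_apply_le _ _
  · rw [Set.indicator_of_notMem hy, Measure.restrict_apply
      (show MeasurableSet {x | y ∈ incrSet (cells q h x) x} from measurable_prodMk_right hS)]
    refine (measure_mono_null (t := ∅) ?_ measure_empty).le
    rintro x ⟨hx1, hx2⟩
    refine hy (hKO x hx2 y fun j => ?_)
    have := (mem_incrSet_cells.1 hx1).1 j (hall j)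
    exact ⟨this.1, this.2.trans_lt (by linarith [(hh j).2])⟩

/-- Fatou's lemma removes the lower limits one by one, reducing to the bound for boxes with sides
below `ε`. -/
theorem setLIntegral_lowerDensity_le_of_subset {d : ℕ} (ν : Measure (Fin d → ℝ))
    [IsFiniteMeasure ν] {l q : List (Fin d)} (hlq : (l ++ q).Nodup) (hall : ∀ j, j ∈ l ++ q)
    {h : Fin d → ℝ} {ε : ℝ} (hε : 0 < ε) (hh : ∀ i ∈ q, 0 < h i ∧ h i < ε)
    {K O : Set (Fin d → ℝ)} (hO : MeasurableSet O)
    (hKO : ∀ x ∈ K, ∀ y, (∀ j, x j < y j ∧ y j < x j + ε) → y ∈ O) :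
    ∫⁻ x in K, lowerDensity ν l q h x ≤ ν O := by
  induction l generalizing q h with
  | nil =>
    simp only [List.nil_append] at hlq hall
    have hpos : 0 < (q.map h).prod := List.prod_pos (by simpa using fun i hi => (hh i hi).1)
    simp only [lowerDensity, div_eq_mul_inv]
    have hm : Measurable fun x => ν (incrSet (cells q h x) x) :=
      measurable_measure_prodMk_left (measurableSet_incrSet_cells q h)
    rw [lintegral_mul_const _ hm,
      ← div_eq_mul_inv]
    refine ENNReal.div_le_of_le_mul' ?_
    exact lintegral_measure_incrSet_le ν hlq hall (fun i => hh i (hall i)) hO hKO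
  | cons i l ih =>
    refine (lintegral_liminf_le fun m => measurable_lowerDensity ν _ _ _).trans ?_
    refine liminf_le_of_frequently_le' (Eventually.frequently ?_)
    filter_upwards [tendsto_one_div_add_atTop_nhds_zero_nat.eventually_lt_const hε] with m hm
    have hv : (0 : ℝ) < 1 / ((m : ℝ) + 1) := by positivity
    refine ih ((List.perm_middle.nodup_iff).2 hlq)
      (fun j => (List.perm_middle.mem_iff).2 (hall j)) ?_
    intro j hj
    rcases eq_or_ne j i with rfl | hne
    · simpa using ⟨by positivity, by simpa using hm⟩
    · simpa [hne] using hh j ((List.mem_cons.1 hj).resolve_left hne)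

/-- The lower density in all directions. -/
noncomputable def fullLowerDensity {d : ℕ} (ν : Measure (Fin d → ℝ)) (x : Fin d → ℝ) : ENNReal :=
  lowerDensity ν (List.finRange d) [] 0 x

theorem measurable_fullLowerDensity {d : ℕ} (ν : Measure (Fin d → ℝ)) [SFinite ν] :
    Measurable (fullLowerDensity ν) :=
  measurable_lowerDensity ν _ _ _

theorem ofReal_iterPartial_jointCdf {d : ℕ} (ν : Measure (Fin d → ℝ)) [IsFiniteMeasure ν]
    {x : Fin d → ℝ} (hx : HasIterPartial (jointCdf ν) (List.finRange d) x) :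
    ENNReal.ofReal (iterPartial (jointCdf ν) (List.finRange d) x) = fullLowerDensity ν x := by
  have := ofReal_incr_iterPartial ν (l := List.finRange d) (q := []) (h := 0) (x := x)
    (by simpa using List.nodup_finRange d) (by simp) hx
  simpa [cells, incr, fullLowerDensity] using this

/-- Outer regularity reduces to open `O`, which is exhausted by the points having a ball of radius
`1 / (n + 1)` inside `O`; small boxes at such points stay in `O`. -/
theorem setLIntegral_fullLowerDensity_le {d : ℕ} (ν : Measure (Fin d → ℝ)) [IsFiniteMeasure ν]
    (A : Set (Fin d → ℝ)) : ∫⁻ x in A, fullLowerDensity ν x ≤ ν A := by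
  rw [A.measure_eq_iInf_isOpen ν]
  refine le_iInf₂ fun O hAO => le_iInf fun hO => ?_
  refine (lintegral_mono_set hAO).trans ?_
  set K : ℕ → Set (Fin d → ℝ) := fun n => {x | Metric.ball x (1 / ((n : ℝ) + 1)) ⊆ O}
  have hK : O = ⋃ n, K n := by
    ext x
    simp only [K, Set.mem_iUnion, Set.mem_ofPred_eq]
    refine ⟨fun hx => ?_, fun ⟨n, hn⟩ => hn (Metric.mem_ball_self (by positivity))⟩
    obtain ⟨ε, hε, hx⟩ := Metric.isOpen_iff.1 hO x hx
    obtain ⟨n, hn⟩ := exists_nat_one_div_lt hε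
    exact ⟨n, (Metric.ball_subset_ball hn.le).trans hx⟩
  have hmono : Monotone K := fun m n hmn x hx =>
    (Metric.ball_subset_ball (one_div_le_one_div_of_le (by positivity) (by gcongr))).trans hx
  rw [hK, setLIntegral_iUnion_of_directed _ hmono.directed_le, ← hK]
  refine iSup_le fun n => setLIntegral_lowerDensity_le_of_subset ν
    (by simpa using List.nodup_finRange d) (by simp) (ε := 1 / ((n : ℝ) + 1)) (by positivity)
    (by simp) hO.measurableSet fun x hx y hy => hx ?_
  rw [Metric.mem_ball, dist_pi_lt_iff (by positivity)]
  intro j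
  rw [Real.dist_eq, abs_lt]
  exact ⟨by linarith [(hy j).1, (by positivity : (0 : ℝ) < 1 / ((n : ℝ) + 1))],
    by linarith [(hy j).2]⟩

/-! ### Increments are bounded by integrals of iterated partial derivatives -/

/-- An inequality version of the fundamental theorem of calculus, which needs neither continuity nor
integrability of `φ'`. -/
theorem ofReal_sub_le_lintegral {φ φ' : ℝ → ℝ} {a b : ℝ} (hab : a ≤ b)
    (hφ : ∀ t ∈ Set.Icc a b, HasDerivAt φ (φ' t) t) {w : ℝ → ENNReal}
    (hw : ∀ t ∈ Set.Icc a b, ENNReal.ofReal (φ' t) ≤ w t) :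
    ENNReal.ofReal (φ b - φ a) ≤ ∫⁻ t, w t := by
  have hle : ∫⁻ t in Set.Icc a b, ENNReal.ofReal (deriv φ t) ≤ ∫⁻ t, w t :=
    (setLIntegral_mono' measurableSet_Icc fun t ht => by
      rw [(hφ t ht).deriv]; exact hw t ht).trans (setLIntegral_le_lintegral _ _)
  -- Otherwise `w` dominates the positive part of the derivative and makes it integrable.
  rcases eq_or_ne (∫⁻ t, w t) ⊤ with htop | htop
  · rw [htop]; exact le_top
  have hmax : ∀ t, ENNReal.ofReal (max (deriv φ t) 0) = ENNReal.ofReal (deriv φ t) := fun t => by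
    simp [ENNReal.ofReal_max]
  have hint : IntegrableOn (fun t => max (deriv φ t) 0) (Set.Icc a b) := by
    refine ⟨((measurable_deriv φ).max measurable_const).aestronglyMeasurable, ?_⟩
    rw [hasFiniteIntegral_iff_ofReal (f := fun t => max (deriv φ t) 0)
      (Eventually.of_forall fun t => le_max_right _ _)]
    simp only [hmax]
    exact hle.trans_lt htop.lt_top
  have hsub := intervalIntegral.sub_le_integral_of_hasDeriv_right_of_le hab
    (fun t ht => (hφ t ht).continuousAt.continuousWithinAt)
    (fun t ht => (hφ t (Set.Ioo_subset_Icc_self ht)).hasDerivWithinAt) hint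
    (fun t ht => by
      rw [(hφ t (Set.Ioo_subset_Icc_self ht)).deriv]; exact le_max_left _ _)
  refine (ENNReal.ofReal_le_ofReal hsub).trans ?_
  rw [intervalIntegral.integral_of_le hab, ← integral_Icc_eq_integral_Ioc,
    ofReal_integral_eq_lintegral_ofReal hint (Eventually.of_forall fun t => le_max_right _ _)]
  simp only [hmax]
  exact hle

theorem HasIterPartial.of_append {d : ℕ} {f : (Fin d → ℝ) → ℝ} {r s : List (Fin d)}
    {x : Fin d → ℝ} (h : HasIterPartial f (r ++ s) x) : HasIterPartial f s x := by
  induction r generalizing x with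
  | nil => exact h
  | cons i r ih =>
    have := (h.1.mono fun t ht => ih ht).self_of_nhds
    rwa [Function.update_eq_self] at this

/-- Each difference in the increment is bounded by the integral of a derivative, so directions pass
one by one from `p` to the front of `s`; hence the reversal in `hps`. The measurable majorant `w`
makes the integrals iterate without joint regularity of the derivatives. -/
theorem ofReal_incr_le_lmarginal {d : ℕ} {F : (Fin d → ℝ) → ℝ} {l : List (Fin d)}
    (hl : l.Nodup) (hF : ∀ x : Fin d → ℝ, (∀ j, x j < 0) → HasIterPartial F l x)
    {w : (Fin d → ℝ) → ENNReal} (hw : Measurable w)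
    (hwF : ∀ x : Fin d → ℝ, (∀ j, x j < 0) → ENNReal.ofReal (iterPartial F l x) ≤ w x)
    {p : List (Fin d × ℝ × ℝ)} {s : List (Fin d)} (hps : l = (p.map Prod.fst).reverse ++ s)
    (hp : ∀ c ∈ p, c.2.1 ≤ c.2.2 ∧ c.2.2 < 0) {x : Fin d → ℝ} (hx : ∀ j, x j < 0) :
    ENNReal.ofReal (incr (iterPartial F s) p x) ≤
      (∫⋯∫⁻_(p.map Prod.fst).toFinset, w ∂fun _ => volume) x := by
  induction p generalizing s x with
  | nil =>
    simp only [List.map_nil, List.reverse_nil, List.nil_append] at hps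
    simpa [incr, ← hps] using hwF x hx
  | cons c p ih =>
    rw [List.forall_mem_cons] at hp
    have hps' : l = (p.map Prod.fst).reverse ++ c.1 :: s := by simpa using hps
    have hc : c.1 ∉ p.map Prod.fst := by
      rw [hps'] at hl
      have := List.nodup_middle.1 hl
      simp only [List.nodup_cons, List.mem_append, List.mem_reverse, not_or] at this
      exact this.1.1
    rw [List.map_cons, List.toFinset_cons, lmarginal_insert _ hw (by simpa using hc)]
    have hneg : ∀ t < 0, ∀ j, Function.update x c.1 t j < 0 := fun t ht j => by
      rcases eq_or_ne j c.1 with rfl | hj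
      · simpa using ht
      · simpa [hj] using hx j
    refine ofReal_sub_le_lintegral (φ := fun t => incr (iterPartial F s) p (Function.update x c.1 t))
      (φ' := fun t => incr (iterPartial F (c.1 :: s)) p (Function.update x c.1 t))
      hp.1.1 (fun t ht => ?_) fun t ht => ih hps' hp.2 (hneg t (ht.2.trans_lt hp.1.2))
    have hcor : AtCorners (fun y => HasDerivAt
        (fun t => iterPartial F s (Function.update y c.1 t)) (iterPartial F (c.1 :: s) y) (y c.1))
        p (Function.update x c.1 t) :=
      AtCorners.of_forall_lt (fun y hy => (HasIterPartial.of_append (hps' ▸ hF y hy)).hasDerivAt)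
        (fun e he => ⟨(hp.2 e he).1.trans_lt (hp.2 e he).2, (hp.2 e he).2⟩)
        (hneg t (ht.2.trans_lt hp.1.2))
    simpa using hasDerivAt_incr hc hcor

theorem measure_negOrthant_le {d : ℕ} (ν : Measure (Fin d → ℝ)) [IsFiniteMeasure ν]
    (hν : ∀ x : Fin d → ℝ, (∀ j, x j < 0) → HasIterPartial (jointCdf ν) (List.finRange d) x) :
    ν {x | ∀ j, x j < 0} ≤ ∫⁻ x in {x | ∀ j, x j < 0}, fullLowerDensity ν x := by
  have hU : MeasurableSet {x : Fin d → ℝ | ∀ j, x j < 0} := by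
    simp only [Set.ofPred_forall]
    exact MeasurableSet.iInter fun j => measurableSet_lt (by fun_prop) (by fun_prop)
  set B : ℕ → Set (Fin d → ℝ) := fun n =>
    {x | ∀ j, -((n : ℝ) + 1) < x j ∧ x j ≤ -(1 / ((n : ℝ) + 1))}
  have hB : {x : Fin d → ℝ | ∀ j, x j < 0} = ⋃ n, B n := by
    ext x
    simp only [B, Set.mem_iUnion, Set.mem_ofPred_eq]
    refine ⟨fun hx => ?_, fun ⟨n, hn⟩ j => (hn j).2.trans_lt ?_⟩
    · have h1 : ∀ᶠ n : ℕ in atTop, ∀ j, -((n : ℝ) + 1) < x j ∧ x j ≤ -(1 / ((n : ℝ) + 1)) := by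
        refine eventually_all.2 fun j => ?_
        have h2 := tendsto_natCast_atTop_atTop.eventually_gt_atTop (-x j)
        have h3 := tendsto_one_div_add_atTop_nhds_zero_nat.eventually_lt_const
          (neg_pos.2 (hx j))
        filter_upwards [h2, h3] with n hn2 hn3
        exact ⟨by linarith, by linarith⟩
      exact h1.exists
    · rw [neg_lt_zero]; positivity
  have hmono : Monotone B := fun m n hmn x hx j =>
    ⟨lt_of_le_of_lt (by gcongr) (hx j).1, (hx j).2.trans (neg_le_neg
      (one_div_le_one_div_of_le (by positivity) (by gcongr)))⟩
  have hle : ∀ n, ν (B n) ≤ ∫⁻ x in {x | ∀ j, x j < 0}, fullLowerDensity ν x := by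
    intro n
    set p : List (Fin d × ℝ × ℝ) := (List.finRange d).reverse.map fun i =>
      (i, -((n : ℝ) + 1), -(1 / ((n : ℝ) + 1)))
    have hfst : p.map Prod.fst = (List.finRange d).reverse := by
      simp [p, Function.comp_def]
    have hp : ∀ c ∈ p, c.2.1 ≤ c.2.2 ∧ c.2.2 < 0 := by
      intro c hc
      obtain ⟨i, -, rfl⟩ := List.mem_map.1 hc
      refine ⟨neg_le_neg ?_, neg_lt_zero.2 (by positivity)⟩
      rw [div_le_iff₀ (by positivity)]
      nlinarith [(n.cast_nonneg : (0 : ℝ) ≤ n)]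
    have hset : B n = incrSet p (fun _ => -1) := by
      ext y
      simp [B, incrSet, p]
    -- The base point `-1` is arbitrary in the orthant: every coordinate is overwritten by an
    -- endpoint from `p`.
    have h1 := ofReal_incr_le_lmarginal (List.nodup_finRange d) hν
      ((measurable_fullLowerDensity ν).indicator hU)
      (fun x hx => by
        rw [Set.indicator_of_mem (show x ∈ {x : Fin d → ℝ | ∀ j, x j < 0} from hx), ofReal_iterPartial_jointCdf ν (hν x hx)])
      (p := p) (s := []) (by rw [hfst]; simp) hp (x := fun _ => -1) (by simp)
    have h2 : iterPartial (jointCdf ν) [] = jointCdf ν := rfl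
    have h3 : (List.finRange d).reverse.toFinset = Finset.univ := by ext; simp
    rw [h2, incr_jointCdf ν (by rw [hfst]; simpa using List.nodup_finRange d)
      (fun c hc => (hp c hc).1), ofReal_measureReal, ← hset, hfst, h3, lmarginal_univ,
      lintegral_indicator hU] at h1
    exact h1
  calc ν {x | ∀ j, x j < 0} = ⨆ n, ν (B n) := by rw [hB, hmono.measure_iUnion]
    _ ≤ _ := iSup_le hle

/-! ### Scheffé's lemma -/

/-- The truncated difference `g - gs n` is dominated by the integrable `g`, so its integral tends to
zero; that integral bounds `ν A - νs n A`. Any singular part of `νs n` is harmless. -/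
theorem exists_tendsto_zero_abs_sub_le {α : Type*} [MeasurableSpace α] {vol ν : Measure α}
    [IsProbabilityMeasure ν] {νs : ℕ → Measure α} [∀ n, IsProbabilityMeasure (νs n)]
    {g : α → ENNReal} {gs : ℕ → α → ENNReal} (hg : Measurable g) (hgs : ∀ n, Measurable (gs n))
    (hν : ∀ A, MeasurableSet A → ν A = ∫⁻ x in A, g x ∂vol)
    (hνs : ∀ n A, MeasurableSet A → ∫⁻ x in A, gs n x ∂vol ≤ νs n A)
    (hlim : ∀ x, Tendsto (fun n => g x - gs n x) atTop (𝓝 0)) :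
    ∃ δ : ℕ → ℝ, Tendsto δ atTop (𝓝 0) ∧ ∀ n A, MeasurableSet A →
      |(νs n).real A - ν.real A| ≤ δ n := by
  have hfin : ∫⁻ x, g x ∂vol ≠ ⊤ := by
    have := hν Set.univ MeasurableSet.univ
    rw [setLIntegral_univ] at this
    exact this ▸ measure_ne_top ν _
  have hsubfin : ∀ n, ∫⁻ x, g x - gs n x ∂vol ≠ ⊤ := fun n =>
    ne_top_of_le_ne_top hfin (lintegral_mono fun x => tsub_le_self)
  have ht : Tendsto (fun n => ∫⁻ x, g x - gs n x ∂vol) atTop (𝓝 0) := by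
    have := tendsto_lintegral_of_dominated_convergence (μ := vol) g
      (fun n => hg.sub (hgs n)) (fun n => Eventually.of_forall fun x => tsub_le_self) hfin
      (Eventually.of_forall hlim)
    simpa using this
  have hone : ∀ n A, MeasurableSet A →
      ν.real A - (νs n).real A ≤ (∫⁻ x, g x - gs n x ∂vol).toReal := by
    intro n A hA
    rw [sub_le_iff_le_add, measureReal_def, measureReal_def,
      ← ENNReal.toReal_add (hsubfin n) (measure_ne_top _ _)]
    refine ENNReal.toReal_mono (ENNReal.add_ne_top.2 ⟨hsubfin n, measure_ne_top _ _⟩) ?_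
    calc ν A = ∫⁻ x in A, g x ∂vol := hν A hA
      _ ≤ ∫⁻ x in A, ((g x - gs n x) + gs n x) ∂vol := lintegral_mono fun x => le_tsub_add
      _ = ∫⁻ x in A, (g x - gs n x) ∂vol + ∫⁻ x in A, gs n x ∂vol :=
        lintegral_add_right _ (hgs n)
      _ ≤ _ := add_le_add (setLIntegral_le_lintegral _ _) (hνs n A hA)
  refine ⟨fun n => (∫⁻ x, g x - gs n x ∂vol).toReal, ?_, fun n A hA => abs_le.2 ⟨?_, ?_⟩⟩
  · exact (ENNReal.tendsto_toReal ENNReal.zero_ne_top).comp ht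
  · linarith [hone n A hA]
  -- Both measures have mass one, so passing to the complement reverses the sign.
  · have := hone n Aᶜ hA.compl
    rw [probReal_compl_eq_one_sub hA, probReal_compl_eq_one_sub hA] at this
    linarith

/-! ### Laws of componentwise maxima -/

theorem ext_of_measureReal_Iic {d : ℕ} {μ ν : Measure (Fin d → ℝ)} [IsProbabilityMeasure μ]
    [IsProbabilityMeasure ν] (h : ∀ z, μ.real (Set.Iic z) = ν.real (Set.Iic z)) : μ = ν := by
  have hspan : IsCountablySpanning (Set.range (Set.Iic : ℝ → Set ℝ)) :=
    ⟨fun n => Set.Iic n, fun n => ⟨n, rfl⟩, by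
      ext x; simpa using exists_nat_ge x⟩
  refine ext_of_generate_finite _
    (generateFrom_eq_pi (C := fun _ : Fin d => Set.range (Set.Iic : ℝ → Set ℝ))
      (fun _ => (borel_eq_generateFrom_Iic ℝ).symm.trans (BorelSpace.measurable_eq).symm)
      (fun _ => hspan)).symm
    (IsPiSystem.pi fun _ => isPiSystem_Iic) ?_ (by simp)
  rintro _ ⟨s, hs, rfl⟩
  choose z hz using fun j => hs j (Set.mem_univ j)
  have : Set.univ.pi s = Set.Iic z := by
    rw [← Set.pi_univ_Iic]; simp only [hz]
  rw [this, ← ofReal_measureReal, h z, ofReal_measureReal]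

/-- The componentwise maximum of `n` vectors. -/
noncomputable def vecMax {d n : ℕ} (u : Fin n → Fin d → ℝ) : Fin d → ℝ :=
  fun j => ⨆ i, u i j

theorem measurable_vecMax {d n : ℕ} : Measurable (vecMax (d := d) (n := n)) :=
  measurable_pi_lambda _ fun j => Measurable.iSup fun i => by fun_prop

theorem vecMax_le_iff {d n : ℕ} [NeZero n] {u : Fin n → Fin d → ℝ} {z : Fin d → ℝ} :
    vecMax u ≤ z ↔ ∀ i, u i ≤ z := by
  simp only [Pi.le_def, vecMax]
  rw [forall_comm]
  exact forall_congr' fun j => ciSup_le_iff (Set.finite_range _).bddAbove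

theorem measureReal_map_vecMax_Iic {d n : ℕ} [NeZero n] (μ : Measure (Fin d → ℝ))
    [IsProbabilityMeasure μ] (z : Fin d → ℝ) :
    ((Measure.pi fun _ : Fin n => μ).map vecMax).real (Set.Iic z) = μ.real (Set.Iic z) ^ n := by
  have : vecMax (d := d) (n := n) ⁻¹' Set.Iic z = Set.univ.pi fun _ => Set.Iic z := by
    ext u
    simp only [Set.mem_preimage, Set.mem_Iic, Set.mem_univ_pi, vecMax_le_iff]
  rw [map_measureReal_apply measurable_vecMax measurableSet_Iic, this, measureReal_def,
    Measure.pi_pi]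
  simp [measureReal_def]

theorem aemeasurable_compMax {Ω : Type*} [MeasurableSpace Ω] {P : Measure Ω} {d : ℕ}
    {X : ℕ → Ω → Fin d → ℝ} (hX : ∀ i, AEMeasurable (X i) P) (n : ℕ) :
    AEMeasurable (compMax X n) P :=
  measurable_vecMax.comp_aemeasurable (f := fun ω (i : Fin n) => X i ω)
    (aemeasurable_pi_lambda _ fun i => hX i)

theorem map_compMax {Ω : Type*} [MeasurableSpace Ω] {P : Measure Ω} [IsProbabilityMeasure P]
    {d : ℕ} {μ : Measure (Fin d → ℝ)} {X : ℕ → Ω → Fin d → ℝ} (hX : ∀ i, HasLaw (X i) μ P)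
    (hind : iIndepFun X P) (n : ℕ) :
    P.map (compMax X n) = (Measure.pi fun _ : Fin n => μ).map vecMax := by
  have h1 : iIndepFun (fun i : Fin n => X i) P := hind.precomp Fin.val_injective
  have h2 := iIndepFun.map_fun_eq_pi_map (fun i : Fin n => (hX i).aemeasurable) h1
  simp only [(hX _).map_eq] at h2
  rw [← h2, AEMeasurable.map_map_of_aemeasurable measurable_vecMax.aemeasurable
    (aemeasurable_pi_lambda _ fun i => (hX i).aemeasurable)]
  rfl

/-! ### Quantile transformation -/

/-- Right-continuity makes the infimum attained, so the equivalence survives jumps and flat pieces.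
-/
theorem quantile_cdf_le_iff (ρ : Measure ℝ) [IsProbabilityMeasure ρ] {q z : ℝ} (h0 : 0 < q)
    (h1 : q < 1) : quantile (fun t => cdf ρ t) q ≤ z ↔ q ≤ cdf ρ z := by
  have hne : {t : ℝ | q ≤ cdf ρ t}.Nonempty :=
    ((tendsto_cdf_atTop ρ).eventually_const_le h1).exists
  have hbdd : BddBelow {t : ℝ | q ≤ cdf ρ t} := by
    obtain ⟨b, hb⟩ := ((tendsto_cdf_atBot ρ).eventually_lt_const h0).exists
    exact ⟨b, fun t ht => le_of_not_gt fun htb =>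
      absurd ((monotone_cdf ρ) htb.le) (not_le.2 (hb.trans_le ht))⟩
  refine ⟨fun h => ?_, fun h => csInf_le hbdd h⟩
  have hrc : Tendsto (cdf ρ) (𝓝[>] z) (𝓝 (cdf ρ z)) :=
    ((cdf ρ).right_continuous z).mono_left (nhdsWithin_mono _ Set.Ioi_subset_Ici_self)
  refine ge_of_tendsto hrc ?_
  filter_upwards [self_mem_nhdsWithin] with t ht
  obtain ⟨s, hs, hst⟩ := exists_lt_of_csInf_lt hne (h.trans_lt ht)
  exact le_trans hs (monotone_cdf ρ hst.le)

theorem measurable_quantile_cdf (ρ : Measure ℝ) [IsProbabilityMeasure ρ] :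
    Measurable (quantile (fun t => cdf ρ t)) := by
  -- Outside `(0, 1]` the infimum is over the whole line or the empty set and takes the default
  -- value `0`. This breaks monotonicity, so the preimages of half-lines are computed by hand.
  have hlow : ∀ q ≤ 0, quantile (fun t => cdf ρ t) q = 0 := fun q hq => by
    have : {t : ℝ | q ≤ cdf ρ t} = Set.univ :=
      Set.eq_univ_of_forall fun t => hq.trans (cdf_nonneg ρ t)
    simp [quantile, this]
  have hhigh : ∀ q, 1 < q → quantile (fun t => cdf ρ t) q = 0 := fun q hq => by
    have : {t : ℝ | q ≤ cdf ρ t} = ∅ :=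
      Set.eq_empty_of_forall_notMem fun t ht => absurd (cdf_le_one ρ t) (not_le.2 (hq.trans_le ht))
    simp [quantile, this]
  refine measurable_of_Iic fun z => ?_
  have : quantile (fun t => cdf ρ t) ⁻¹' Set.Iic z =
      (Set.Ioo 0 1 ∩ Set.Iic (cdf ρ z)) ∪
      ((Set.Iic 0 ∪ Set.Ioi 1) ∩ {_q : ℝ | (0 : ℝ) ≤ z}) ∪
      ({1} ∩ {_q : ℝ | quantile (fun t => cdf ρ t) 1 ≤ z}) := by
    ext q
    simp only [Set.mem_preimage, Set.mem_Iic, Set.mem_union, Set.mem_inter_iff, Set.mem_Ioo,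
      Set.mem_Ioi, Set.mem_singleton_iff, Set.mem_ofPred_eq]
    rcases le_or_gt q 0 with h0 | h0
    · rw [hlow q h0]; grind
    rcases lt_trichotomy q 1 with h1 | h1 | h1
    · rw [quantile_cdf_le_iff ρ h0 h1]; grind
    · subst h1; grind
    · rw [hhigh q h1]; grind
  rw [this]
  exact ((measurableSet_Ioo.inter measurableSet_Iic).union
    ((measurableSet_Iic.union measurableSet_Ioi).inter (MeasurableSet.const _))).union
    ((measurableSet_singleton _).inter (MeasurableSet.const _))

/-- The componentwise quantile transformation. -/
noncomputable def vecQuantile {d : ℕ} (μ : Measure (Fin d → ℝ)) (u : Fin d → ℝ) : Fin d → ℝ :=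
  fun j => quantile (marginCdf μ j) (u j)

theorem marginCdf_eq {d : ℕ} (μ : Measure (Fin d → ℝ)) (j : Fin d) :
    marginCdf μ j = fun t => cdf (μ.map fun x => x j) t := by
  funext t; rw [marginCdf]

theorem isProbabilityMeasure_map_eval {d : ℕ} (μ : Measure (Fin d → ℝ)) [IsProbabilityMeasure μ]
    (j : Fin d) : IsProbabilityMeasure (μ.map fun x => x j) :=
  Measure.isProbabilityMeasure_map (measurable_pi_apply j).aemeasurable

theorem measurable_vecQuantile {d : ℕ} (μ : Measure (Fin d → ℝ)) [IsProbabilityMeasure μ] :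
    Measurable (vecQuantile μ) :=
  measurable_pi_lambda _ fun j => by
    have := isProbabilityMeasure_map_eval μ j
    have h : Measurable (quantile (marginCdf μ j)) := by
      rw [marginCdf_eq]; exact measurable_quantile_cdf _
    exact h.comp (measurable_pi_apply j)

theorem IsCopula.ae_mem_Ioo {d : ℕ} {κ : Measure (Fin d → ℝ)} (hκ : IsCopula κ) :
    ∀ᵐ u ∂κ, ∀ j, u j ∈ Set.Ioo (0 : ℝ) 1 := by
  refine ae_all_iff.2 fun j => ?_
  have h : ∀ᵐ t ∂(κ.map fun x => x j), t ∈ Set.Ioo (0 : ℝ) 1 := by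
    rw [hκ.margin j, ← restrict_Ioo_eq_restrict_Icc]
    exact ae_restrict_mem measurableSet_Ioo
  exact ae_of_ae_map (measurable_pi_apply j).aemeasurable h

theorem IsCopula.ae_vecMax_mem_Ioo {d n : ℕ} [NeZero n] {κ : Measure (Fin d → ℝ)}
    (hκ : IsCopula κ) :
    ∀ᵐ u ∂((Measure.pi fun _ : Fin n => κ).map vecMax), ∀ j, u j ∈ Set.Ioo (0 : ℝ) 1 := by
  have := hκ.isProb
  rw [ae_map_iff measurable_vecMax.aemeasurable]
  · have h : ∀ᵐ u ∂(Measure.pi fun _ : Fin n => κ), ∀ i j, u i j ∈ Set.Ioo (0 : ℝ) 1 :=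
      ae_all_iff.2 fun i => (Measure.tendsto_eval_ae_ae (μ := fun _ : Fin n => κ) (i := i)).eventually
        hκ.ae_mem_Ioo
    filter_upwards [h] with u hu j
    obtain ⟨i, hi⟩ := exists_eq_ciSup_of_finite (f := fun i => u i j)
    rw [vecMax, ← hi]
    exact hu i j
  · simp only [Set.ofPred_forall]
    exact MeasurableSet.iInter fun j => measurable_pi_apply j measurableSet_Ioo

/-- Both distribution functions at `z` equal the `n`-th power of `C` at the marginal values: on one
side by Sklar's identity, on the other because `quantile u ≤ z` means `u ≤ F z` on `(0, 1)`. -/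
theorem map_vecMax_eq_map_vecQuantile {d n : ℕ} [NeZero n] {κ μ : Measure (Fin d → ℝ)}
    [IsProbabilityMeasure μ] (hκ : IsCopulaOf κ μ) :
    (Measure.pi fun _ : Fin n => μ).map vecMax =
      ((Measure.pi fun _ : Fin n => κ).map vecMax).map (vecQuantile μ) := by
  have := hκ.1.isProb
  have hm := measurable_vecMax (d := d) (n := n)
  have i1 := Measure.isProbabilityMeasure_map (μ := Measure.pi fun _ : Fin n => κ) hm.aemeasurable
  have i2 := Measure.isProbabilityMeasure_map (μ := Measure.pi fun _ : Fin n => μ) hm.aemeasurable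
  have i3 := Measure.isProbabilityMeasure_map
    (μ := (Measure.pi fun _ : Fin n => κ).map vecMax) (measurable_vecQuantile μ).aemeasurable
  refine ext_of_measureReal_Iic fun z => ?_
  rw [map_measureReal_apply (measurable_vecQuantile μ) measurableSet_Iic]
  have : vecQuantile μ ⁻¹' Set.Iic z =ᵐ[(Measure.pi fun _ : Fin n => κ).map vecMax]
      Set.Iic fun j => marginCdf μ j (z j) := by
    filter_upwards [hκ.1.ae_vecMax_mem_Ioo (n := n)] with u hu
    refine propext ?_
    change vecQuantile μ u ≤ z ↔ u ≤ fun j => marginCdf μ j (z j)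
    refine forall_congr' fun j => ?_
    have := isProbabilityMeasure_map_eval μ j
    rw [vecQuantile, marginCdf_eq]
    exact quantile_cdf_le_iff _ (hu j).1 (hu j).2
  rw [measureReal_congr this, measureReal_map_vecMax_Iic, measureReal_map_vecMax_Iic]
  congr 1
  exact hκ.2 z

/-- The law of `n (M - 1)`, where `M` is the componentwise maximum of `n` independent vectors with
law `κ`. -/
noncomputable def scaledMaxLaw {d : ℕ} (κ : Measure (Fin d → ℝ)) (n : ℕ) : Measure (Fin d → ℝ) :=
  ((Measure.pi fun _ : Fin n => κ).map vecMax).map fun u j => n * (u j - 1)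

theorem isProbabilityMeasure_scaledMaxLaw {d : ℕ} (κ : Measure (Fin d → ℝ))
    [IsProbabilityMeasure κ] (n : ℕ) : IsProbabilityMeasure (scaledMaxLaw κ n) :=
  haveI := Measure.isProbabilityMeasure_map (μ := Measure.pi fun _ : Fin n => κ)
    (measurable_vecMax (d := d)).aemeasurable
  Measure.isProbabilityMeasure_map
    (by fun_prop : Measurable fun (u : Fin d → ℝ) j => (n : ℝ) * (u j - 1)).aemeasurable

theorem jointCdf_scaledMaxLaw {d : ℕ} (κ : Measure (Fin d → ℝ)) [IsProbabilityMeasure κ] (n : ℕ)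
    [NeZero n] (x : Fin d → ℝ) :
    jointCdf (scaledMaxLaw κ n) x = jointCdf κ (fun j => 1 + x j / n) ^ n := by
  have hn : (0 : ℝ) < n := by exact_mod_cast NeZero.pos n
  rw [jointCdf, scaledMaxLaw, map_measureReal_apply (by fun_prop) measurableSet_Iic]
  have : (fun (u : Fin d → ℝ) j => (n : ℝ) * (u j - 1)) ⁻¹' Set.Iic x =
      Set.Iic fun j => 1 + x j / n := by
    ext u
    refine forall_congr' fun j => ?_
    rw [← sub_le_iff_le_add', le_div_iff₀ hn, mul_comm]
  rw [this, measureReal_map_vecMax_Iic]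
  rfl

theorem map_compMax_eq_map_scaledMaxLaw {Ω : Type*} [MeasurableSpace Ω] {P : Measure Ω}
    [IsProbabilityMeasure P] {d : ℕ} {μ κ : Measure (Fin d → ℝ)} [IsProbabilityMeasure μ]
    (hκ : IsCopulaOf κ μ) {X : ℕ → Ω → Fin d → ℝ} (hX : ∀ i, HasLaw (X i) μ P)
    (hind : iIndepFun X P) (n : ℕ) [NeZero n] :
    P.map (compMax X n) = (scaledMaxLaw κ n).map fun y => vecQuantile μ fun j => 1 + y j / n := by
  rw [map_compMax hX hind, map_vecMax_eq_map_vecQuantile hκ, scaledMaxLaw,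
    Measure.map_map (g := fun y : Fin d → ℝ => vecQuantile μ fun j => 1 + y j / (n : ℝ))
      ((measurable_vecQuantile μ).comp (by fun_prop)) (by fun_prop)]
  congr 1
  have hn : (n : ℝ) ≠ 0 := NeZero.ne _
  funext u
  simp only [Function.comp_apply]
  congr 1
  funext j
  field_simp
  ring

/-! ### Homogeneity of the norm and scaled tails of the copula -/

theorem IsDNorm.smul {d : ℕ} {N : (Fin d → ℝ) → ℝ} (hN : IsDNorm N) (c : ℝ) (x : Fin d → ℝ) :
    N (fun j => c * x j) = |c| * N x := by
  obtain ⟨ρ, -, -, -, h⟩ := hN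
  rw [h, h, ← integral_const_mul]
  congr 1
  funext z
  rw [Real.mul_iSup_of_nonneg (abs_nonneg c)]
  simp only [abs_mul, mul_assoc]

theorem isOpen_negOrthant (d : ℕ) : IsOpen {x : Fin d → ℝ | ∀ j, x j < 0} := by
  simp only [Set.ofPred_forall]
  exact isOpen_iInter_of_finite fun j => isOpen_lt (by fun_prop) (by fun_prop)

theorem tendsto_scaledTail_of_hasExpansion {d : ℕ} {C N : (Fin d → ℝ) → ℝ} (hN : IsDNorm N)
    (hC : HasExpansion C N) {x : Fin d → ℝ} (hx : ∀ j, x j < 0) :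
    Tendsto (fun n => scaledTail C n x) atTop (𝓝 (-N x)) := by
  set u : ℕ → Fin d → ℝ := fun n j => 1 + x j / n
  have hu : Tendsto u atTop (𝓝[Set.Icc 0 1] 1) := by
    have h0 : ∀ j, Tendsto (fun n : ℕ => x j / (n : ℝ)) atTop (𝓝 0) := fun j =>
      tendsto_const_div_atTop_nhds_zero_nat _
    refine tendsto_nhdsWithin_iff.2 ⟨tendsto_pi_nhds.2 fun j => by
      simpa using (h0 j).const_add 1, ?_⟩
    have h1 : ∀ᶠ n : ℕ in atTop, ∀ j, -1 < x j / (n : ℝ) :=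
      eventually_all.2 fun j => (h0 j).eventually_const_lt (by norm_num)
    filter_upwards [h1] with n hn
    refine ⟨fun j => ?_, fun j => ?_⟩
    · have := hn j; simp only [u, Pi.zero_apply]; linarith
    · have : x j / (n : ℝ) ≤ 0 := div_nonpos_of_nonpos_of_nonneg (hx j).le n.cast_nonneg
      simp only [u, Pi.one_apply]; linarith
  have h1 := hC.comp_tendsto hu
  have h2 : ((fun v : Fin d → ℝ => 1 - v) ∘ u) =O[atTop] fun n : ℕ => (1 : ℝ) / n := by
    refine IsBigO.of_bound ‖x‖ (Eventually.of_forall fun n => ?_)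
    have : ((fun v : Fin d → ℝ => 1 - v) ∘ u) n = (-(1 / (n : ℝ))) • x := by
      funext j; simp [u]; ring
    rw [this, norm_smul, norm_neg, mul_comm]
  have h3 := (h1.trans_isBigO h2).tendsto_div_nhds_zero
  have h4 := h3.sub_const (N x)
  rw [zero_sub] at h4
  refine h4.congr' ?_
  filter_upwards [eventually_ne_atTop 0] with n hn
  have hn' : (n : ℝ) ≠ 0 := by exact_mod_cast hn
  have hNn : N (1 - u n) = 1 / n * N x := by
    have : 1 - u n = fun j => -(1 / (n : ℝ)) * x j := by
      funext j; simp [u]; ring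
    rw [this, hN.smul, abs_neg, abs_of_nonneg (by positivity)]
  simp only [Function.comp_apply, hNn, scaledTail]
  change (C (u n) - _) / _ - _ = n * (C (u n) - 1)
  field_simp
  ring

/-- Near `x` and for large `n` the points `1 + y / n` lie in `[u₀, 1]`, where homogeneity of `N`
cancels the factor `n`. Equality on an open set carries over to all iterated partial derivatives. -/
theorem IsGPC.scaledTail_eq {d : ℕ} {C N : (Fin d → ℝ) → ℝ} (hN : IsDNorm N) (hC : IsGPC C N)
    {x : Fin d → ℝ} (hx : ∀ j, x j < 0) :
    ∀ᶠ n : ℕ in atTop, ∃ U : Set (Fin d → ℝ), IsOpen U ∧ x ∈ U ∧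
      ∀ y ∈ U, -N y = scaledTail C n y := by
  obtain ⟨u₀, hu₀, hC⟩ := hC
  have h1 : ∀ᶠ n : ℕ in atTop, ∀ j, u₀ j - 1 < x j / (n : ℝ) :=
    eventually_all.2 fun j => (tendsto_const_div_atTop_nhds_zero_nat (x j)).eventually_const_lt
      (by linarith [(hu₀ j).2])
  filter_upwards [h1, eventually_ne_atTop 0] with n hn hn0
  have hpos : (0 : ℝ) < n := by exact_mod_cast Nat.pos_of_ne_zero hn0
  refine ⟨{y | ∀ j, y j < 0} ∩ {y | ∀ j, u₀ j - 1 < y j / (n : ℝ)},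
    (isOpen_negOrthant d).inter ?_, ⟨hx, hn⟩, ?_⟩
  · simp only [Set.ofPred_forall]
    exact isOpen_iInter_of_finite fun j => isOpen_lt (by fun_prop) (by fun_prop)
  · rintro y ⟨hy0, hy⟩
    rw [scaledTail, hC]
    · have : (1 - fun j => 1 + y j / (n : ℝ)) = fun j => -(1 / (n : ℝ)) * y j := by
        funext j; simp; ring
      rw [this, hN.smul, abs_neg, abs_of_nonneg (by positivity)]
      field_simp
      ring
    · refine ⟨fun j => ?_, fun j => ?_⟩
      · have : u₀ j - 1 < y j / (n : ℝ) := hy j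
        simp only; linarith
      · have : y j / (n : ℝ) ≤ 0 := div_nonpos_of_nonpos_of_nonneg (hy0 j).le hpos.le
        simp only [Pi.one_apply]; linarith

/-- Under either assumption on the copula, `scaledTail C n` converges to `-N` together with its
iterated partial derivatives over sublists of the coordinates. -/
theorem scaledTail_partials {d : ℕ} {C N : (Fin d → ℝ) → ℝ} (hN : IsDNorm N)
    (hNd : HasBlockPartials N) (hC : IsGPC C N ∨ (HasExpansion C N ∧ HasPartialLimits C N))
    {x : Fin d → ℝ} (hx : ∀ j, x j < 0) {l : List (Fin d)} (hl : l.Sublist (List.finRange d)) :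
    (∀ᶠ n : ℕ in atTop, HasIterPartial (scaledTail C n) l x) ∧
    Tendsto (fun n : ℕ => iterPartial (scaledTail C n) l x) atTop
      (𝓝 (iterPartial (fun y => -N y) l x)) := by
  have hblock : l ≠ [] → IsBlock l := fun h => ⟨h, (List.sortedLT_finRange d).pairwise.sublist hl⟩
  rcases hC with hC | ⟨hC, hC'⟩
  · have hev := hC.scaledTail_eq hN hx
    refine ⟨hev.mono fun n ⟨U, hU, hxU, h⟩ => ?_, ?_⟩
    · rcases eq_or_ne l [] with rfl | hne
      · trivial
      · exact (hNd x hx l (hblock hne)).neg.congr hU h l hxU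
    · exact tendsto_const_nhds.congr' (hev.mono fun n ⟨U, hU, hxU, h⟩ =>
        iterPartial_congr hU h l hxU)
  · rcases eq_or_ne l [] with rfl | hne
    · exact ⟨Eventually.of_forall fun _ => trivial, tendsto_scaledTail_of_hasExpansion hN hC hx⟩
    · exact hC' x hx l (hblock hne)

/-! ### Convergence of the densities -/

theorem hasIterPartial_exp_neg {d : ℕ} {N : (Fin d → ℝ) → ℝ} (hNd : HasBlockPartials N)
    {x : Fin d → ℝ} (hx : ∀ j, x j < 0) :
    HasIterPartial (fun y => Real.exp (-N y)) (List.finRange d) x ∧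
    iterPartial (fun y => Real.exp (-N y)) (List.finRange d) x =
      ((listPartitions (List.finRange d)).map fun π =>
        partitionTerm (fun _ => Real.exp) (fun y => -N y) π x).sum := by
  refine iterPartial_comp (ψ := fun _ => Real.exp) (fun _ y => Real.hasDerivAt_exp y) _
    fun l hl => ?_
  rcases eq_or_ne l [] with rfl | hne
  · trivial
  · exact (hNd x hx l ⟨hne, (List.sortedLT_finRange d).pairwise.sublist hl⟩).neg

theorem jointCdf_scaledMaxLaw_eq_powDeriv {d : ℕ} (κ : Measure (Fin d → ℝ))
    [IsProbabilityMeasure κ] {n : ℕ} (hn : n ≠ 0) :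
    jointCdf (scaledMaxLaw κ n) = fun x => powDeriv n 0 (scaledTail (jointCdf κ) n x) := by
  have : NeZero n := ⟨hn⟩
  have hn' : (n : ℝ) ≠ 0 := by exact_mod_cast hn
  funext x
  rw [jointCdf_scaledMaxLaw, powDeriv, scaledTail, mul_div_cancel_left₀ _ hn']
  simp

theorem tendsto_fullLowerDensity {d : ℕ} {N : (Fin d → ℝ) → ℝ} (hN : IsDNorm N)
    (hNd : HasBlockPartials N) {ν κ : Measure (Fin d → ℝ)} [IsProbabilityMeasure ν]
    [IsProbabilityMeasure κ] (hν : ∀ x : Fin d → ℝ, x ≤ 0 → jointCdf ν x = Real.exp (-N x))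
    (hC : IsGPC (jointCdf κ) N ∨ (HasExpansion (jointCdf κ) N ∧ HasPartialLimits (jointCdf κ) N))
    {x : Fin d → ℝ} (hx : ∀ j, x j < 0) :
    HasIterPartial (jointCdf ν) (List.finRange d) x ∧
    Tendsto (fun n => fullLowerDensity (scaledMaxLaw κ n) x) atTop
      (𝓝 (fullLowerDensity ν x)) := by
  obtain ⟨h1, h2⟩ := hasIterPartial_exp_neg hNd hx
  have hcongr : ∀ y ∈ {y : Fin d → ℝ | ∀ j, y j < 0}, Real.exp (-N y) = jointCdf ν y :=
    fun y hy => (hν y fun j => (hy j).le).symm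
  have hhas := h1.congr (isOpen_negOrthant d) hcongr _ hx
  refine ⟨hhas, ?_⟩
  rw [← ofReal_iterPartial_jointCdf ν hhas,
    ← iterPartial_congr (isOpen_negOrthant d) hcongr _ hx, h2]
  have hlim := tendsto_partitionTerm_sum (ψ := powDeriv) (f := scaledTail (jointCdf κ))
    (φ := fun _ => Real.exp) (f₀ := fun y => -N y) (l := List.finRange d) (x := x)
    (tendsto_powDeriv (scaledTail_partials hN hNd hC hx (List.nil_sublist _)).2)
    fun l hl => (scaledTail_partials hN hNd hC hx hl).2
  refine ((ENNReal.continuous_ofReal.tendsto _).comp hlim).congr' ?_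
  have hev : ∀ᶠ n in atTop, ∀ l ∈ (List.finRange d).sublists,
      HasIterPartial (scaledTail (jointCdf κ) n) l x := by
    have hfin : {l | l ∈ (List.finRange d).sublists}.Finite := List.finite_toSet _
    exact (eventually_all_finite hfin).2 fun l hl =>
      (scaledTail_partials hN hNd hC hx (List.mem_sublists.1 hl)).1
  filter_upwards [hev, eventually_ne_atTop 0] with n hn hn0
  have := isProbabilityMeasure_scaledMaxLaw κ n
  obtain ⟨h3, h4⟩ := iterPartial_comp (hasDerivAt_powDeriv n) (List.finRange d)
    fun l hl => hn l (List.mem_sublists.2 hl)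
  rw [← jointCdf_scaledMaxLaw_eq_powDeriv κ hn0] at h3 h4
  rw [Function.comp_apply, ← h4, ofReal_iterPartial_jointCdf _ h3]

/-- The orthant contains the lower sets of points `(-ε, …, -ε)`, of mass `exp (-ε N 1)`, which tends
to `1`. -/
theorem measure_negOrthant_eq_one {d : ℕ} {N : (Fin d → ℝ) → ℝ} (hN : IsDNorm N)
    {ν : Measure (Fin d → ℝ)} [IsProbabilityMeasure ν]
    (hν : ∀ x : Fin d → ℝ, x ≤ 0 → jointCdf ν x = Real.exp (-N x)) :
    ν {x | ∀ j, x j < 0} = 1 := by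
  refine le_antisymm prob_le_one ?_
  have h0 := tendsto_one_div_add_atTop_nhds_zero_nat (𝕜 := ℝ)
  have ht : Tendsto (fun n : ℕ => ENNReal.ofReal (Real.exp (-(1 / ((n : ℝ) + 1) * N 1)))) atTop
      (𝓝 1) := by
    have := (Real.continuous_exp.tendsto _).comp (h0.mul_const (N 1)).neg
    simpa [Function.comp_def] using (ENNReal.continuous_ofReal.tendsto _).comp this
  refine le_of_tendsto' ht fun n => ?_
  have hpos : (0 : ℝ) < 1 / ((n : ℝ) + 1) := by positivity
  have h1 := hN.smul (-(1 / ((n : ℝ) + 1))) 1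
  rw [abs_neg, abs_of_pos hpos] at h1
  rw [← h1, ← hν _ fun j => by simpa using by positivity, jointCdf, ofReal_measureReal]
  refine measure_mono fun x hx j => (hx j).trans_lt ?_
  simpa using by positivity

/-- The laws of the scaled maxima of the copula converge to the max-stable law in total
variation. -/
theorem exists_abs_scaledMaxLaw_sub_le {d : ℕ} {N : (Fin d → ℝ) → ℝ} (hN : IsDNorm N)
    (hNd : HasBlockPartials N) {ν κ : Measure (Fin d → ℝ)} [IsProbabilityMeasure ν]
    [IsProbabilityMeasure κ] (hν : ∀ x : Fin d → ℝ, x ≤ 0 → jointCdf ν x = Real.exp (-N x))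
    (hC : IsGPC (jointCdf κ) N ∨
      (HasExpansion (jointCdf κ) N ∧ HasPartialLimits (jointCdf κ) N)) :
    ∃ δ : ℕ → ℝ, Tendsto δ atTop (𝓝 0) ∧ ∀ n A, MeasurableSet A →
      |(scaledMaxLaw κ n).real A - ν.real A| ≤ δ n := by
  have hprob := isProbabilityMeasure_scaledMaxLaw κ
  set U : Set (Fin d → ℝ) := {x | ∀ j, x j < 0} with hUdef
  have hU : MeasurableSet U := (isOpen_negOrthant d).measurableSet
  set g : (Fin d → ℝ) → ENNReal := U.indicator (fullLowerDensity ν)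
  have hg : Measurable g := (measurable_fullLowerDensity ν).indicator hU
  have hle : ∀ A, MeasurableSet A → ∫⁻ x in A, g x ≤ ν A := fun A _ =>
    (lintegral_mono fun x => Set.indicator_le_self U _ x).trans
      (setLIntegral_fullLowerDensity_le ν A)
  have hdens : ∀ x ∈ U, _ := fun x hx => tendsto_fullLowerDensity hN hNd hν hC (x := x) hx
  have htotal : 1 ≤ ∫⁻ x, g x := by
    rw [← measure_negOrthant_eq_one hN hν, lintegral_indicator hU]
    exact measure_negOrthant_le ν fun x hx => (hdens x hx).1
  have heq : ∀ A, MeasurableSet A → ν A = ∫⁻ x in A, g x := by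
    intro A hA
    refine le_antisymm ?_ (hle A hA)
    -- A subdensity of total mass one is a density: a deficit on `A` could not be made up on `Aᶜ`.
    have h1 : ν A + ν Aᶜ ≤ (∫⁻ x in A, g x) + ν Aᶜ := by
      rw [prob_add_prob_compl hA]
      refine htotal.trans ?_
      rw [← lintegral_add_compl g hA]
      exact add_le_add le_rfl (hle _ hA.compl)
    exact (ENNReal.add_le_add_iff_right (measure_ne_top ν _)).1 h1
  refine exists_tendsto_zero_abs_sub_le hg
    (fun n => measurable_fullLowerDensity (scaledMaxLaw κ n)) heq
    (fun n A _ => setLIntegral_fullLowerDensity_le _ A) fun x => ?_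
  by_cases hx : x ∈ U
  · have hgx : g x = fullLowerDensity ν x := Set.indicator_of_mem hx _
    have hfin : g x ≠ ⊤ := by
      rw [hgx, ← ofReal_iterPartial_jointCdf ν (hdens x hx).1]; exact ENNReal.ofReal_ne_top
    have := ENNReal.Tendsto.sub (tendsto_const_nhds (x := g x)) (hgx ▸ (hdens x hx).2)
      (Or.inl hfin)
    simpa using this
  -- Off the orthant the truncated difference is zero whatever the approximating lower densities do.
  · have hgx : g x = 0 := Set.indicator_of_notMem hx _
    simp [hgx]

theorem mainTheorem4 {d : ℕ}
    {Ω : Type*} [MeasurableSpace Ω] (P : Measure Ω) [IsProbabilityMeasure P]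
    {Ω' : Type*} [MeasurableSpace Ω'] (Q : Measure Ω') [IsProbabilityMeasure Q]
    -- the `D`-norm, differentiable up to order `d`
    (N : (Fin d → ℝ) → ℝ) (hN : IsDNorm N) (hNd : HasBlockPartials N)
    -- the vector `η` with distribution function `G(x) = exp(-‖x‖_D)`, `x ≤ 0`
    (η : Ω' → Fin d → ℝ) (hη : AEMeasurable η Q)
    (hG : ∀ x : Fin d → ℝ, x ≤ 0 → jointCdf (Q.map η) x = Real.exp (-N x))
    -- the law `μ` of `X`, its copula, and independent copies of `X`
    (μ κ : Measure (Fin d → ℝ)) [IsProbabilityMeasure μ] (hκ : IsCopulaOf κ μ)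
    (X : ℕ → Ω → Fin d → ℝ) (hX : ∀ i, HasLaw (X i) μ P) (hind : iIndepFun X P)
    -- the copula is a GPC, or lies in a differentiable neighbourhood of one
    (hC : IsGPC (jointCdf κ) N ∨
      (HasExpansion (jointCdf κ) N ∧ HasPartialLimits (jointCdf κ) N)) :
    Tendsto (fun n : ℕ => ⨆ A : {A : Set (Fin d → ℝ) // MeasurableSet A},
        |P.real {ω | compMax X n ω ∈ A.1} -
          Q.real {ω | (fun j => quantile (marginCdf μ j) (1 + η ω j / n)) ∈ A.1}|)
      atTop (𝓝 0) := by
  have := hκ.1.isProb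
  have hνp := Measure.isProbabilityMeasure_map (μ := Q) hη
  obtain ⟨δ, hδ, hle⟩ := exists_abs_scaledMaxLaw_sub_le hN hNd hG hC
  refine squeeze_zero' (Eventually.of_forall fun n => Real.iSup_nonneg fun A => abs_nonneg _)
    ?_ hδ
  filter_upwards [eventually_ne_atTop 0] with n hn
  have : NeZero n := ⟨hn⟩
  have : Nonempty {A : Set (Fin d → ℝ) // MeasurableSet A} := ⟨⟨∅, MeasurableSet.empty⟩⟩
  refine ciSup_le fun A => ?_
  set T : (Fin d → ℝ) → Fin d → ℝ := fun y => vecQuantile μ fun j => 1 + y j / n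
  have hT : Measurable T := (measurable_vecQuantile μ).comp (by fun_prop)
  have h1 : P.real {ω | compMax X n ω ∈ A.1} = (scaledMaxLaw κ n).real (T ⁻¹' A.1) := by
    rw [← map_measureReal_apply hT A.2, ← map_compMax_eq_map_scaledMaxLaw hκ hX hind n,
      map_measureReal_apply_of_aemeasurable
        (aemeasurable_compMax (fun i => (hX i).aemeasurable) n) A.2]
    rfl
  have h2 : Q.real {ω | (fun j => quantile (marginCdf μ j) (1 + η ω j / n)) ∈ A.1} =
      (Q.map η).real (T ⁻¹' A.1) := by
    rw [map_measureReal_apply_of_aemeasurable hη (hT A.2)]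
    rfl
  rw [h1, h2]
  exact hle n _ (hT A.2)
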